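/- All simplicial complexes are finite; $n$ denotes the number of (nonempty) simplices of a complex. A complex is given to an algorithm as the list of its simplices, on the vertex set $\{0,\dots,m-1\}$, and polynomial time refers to Turing machines and the length of the input (equivalently, to $n$). A Morse matching $M$ on a simplicial complex $\mathcal K$ is a set of pairs $(a,b)$ of simplices, $a$ a codimension-one face of $b$, such that every simplex is in at most one pair and there is no cycle $a_1\prec b_1\succ a_2\prec b_2\cdots a_k\prec b_k\succ a_1$ with $k\ge 2$, $(a_i,b_i)\in M$ and the $b_i$ distinct, where $a\prec b$ means that $a$ is a codimension-one face of $b$. The simplices in no pair are critical; $c(M)$ is their number. MinMM is the problem of computing, for a given $\mathcal K$, a Morse matching with the least number of critical simplices. For $\alpha:\mathbb N\to\mathbb R$, an $\alpha$-approximation algorithm for MinMM is a polynomial-time algorithm that returns for every $\mathcal K$ a Morse matching $M$ with $c(M)\le\alpha(n)\,c(M_{\mathrm{opt}})$, where $M_{\mathrm{opt}}$ is an optimal Morse matching; it is an $O(n^{1-\epsilon})$-approximation algorithm if $\alpha(n)=O(n^{1-\epsilon})$. A complex is collapsible if a finite sequence of elementary collapses reduces it to a single vertex. For a vertex $v$ of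 a complex $\mathcal K$ with $n$ simplices and an integer $c\ge1$, the amplified complex $\hat{\mathcal K}_c$ is the wedge sum at $v$ of $n^{c-1}$ copies of $\mathcal K$. **Lemma.** Let $0<\epsilon\le 1$, and suppose that $A$ is an $O(n^{1-\epsilon})$-approximation algorithm for MinMM, with approximation ratio $\alpha$. Then there is a polynomial-time algorithm that decides whether a given simplicial complex is collapsible. Moreover, put $c=\lfloor 1/\epsilon+1\rfloor$, and let $p,N>0$ be real numbers such that $\alpha(n)\le p\,n^{1-\epsilon}$ for all $n\ge N$. Then for every simplicial complex $\mathcal K$ with $n>\max\bigl(p^{1/(c\epsilon-1)},N\bigr)$ simplices and every choice of the base vertex, $\mathcal K$ is collapsible if and only if the Morse matching that $A$ returns for $\hat{\mathcal K}_c$ has fewer than $n^{c-1}$ critical simplices. -/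

import Mathlib

/-! ### Partial matchings of a poset -/

section Matchings

variable {P : Type*} [PartialOrder P]

/-- A partial matching of the Hasse diagram of a poset: a set of pairs `(a, b)` with `a ⋖ b` such
that every element of the poset belongs to at most one pair. -/
def IsPartialMatching (M : Set (P × P)) : Prop :=
  (∀ p ∈ M, p.1 ⋖ p.2) ∧
    ∀ x : P, ∀ p ∈ M, ∀ q ∈ M, (x = p.1 ∨ x = p.2) → (x = q.1 ∨ x = q.2) → p = q

/-- There is no cycle `a₁ ⋖ b₁ ⋗ a₂ ⋖ b₂ ⋗ ⋯ ⋗ aₙ ⋖ bₙ ⋗ a₁` with `n ≥ 2`, all `(aᵢ, bᵢ) ∈ M` and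
the `bᵢ` distinct. The indices are taken cyclically. -/
def IsAcyclicMatching (M : Set (P × P)) : Prop :=
  ¬ ∃ n : ℕ, 2 ≤ n ∧ ∃ a b : ZMod n → P,
    Function.Injective b ∧ ∀ i, (a i, b i) ∈ M ∧ a i ⋖ b i ∧ a (i + 1) ⋖ b i

end Matchings

/-! ### Morse matchings of a simplicial complex -/

section Morse

variable {V : Type*}

/-- The face poset of a simplicial complex: its (nonempty) simplices, ordered by inclusion. -/
abbrev FacePoset (K : AbstractSimplicialComplex V) : Type _ :=
  {s : Finset V // s ∈ K.faces}

/-- A Morse matching is an acyclic partial matching of the face poset. -/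
def IsMorseMatching (K : AbstractSimplicialComplex V) (M : Set (FacePoset K × FacePoset K)) :
    Prop :=
  IsPartialMatching M ∧ IsAcyclicMatching M

/-- The critical simplices of `M`: the simplices that belong to no pair of `M`. -/
def criticalSimplices (K : AbstractSimplicialComplex V) (M : Set (FacePoset K × FacePoset K)) :
    Set (FacePoset K) :=
  {s | ∀ p ∈ M, s ≠ p.1 ∧ s ≠ p.2}

/-- The number of critical simplices of `M` (used for finite complexes). -/
noncomputable def numCritical (K : AbstractSimplicialComplex V)
    (M : Set (FacePoset K × FacePoset K)) : ℕ :=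
  (criticalSimplices K M).ncard

end Morse

/-! ### Collapses -/

section Collapse

variable {V : Type*}

/-- An elementary collapse of `K` onto `L`: the complex `L` is obtained from `K` by deleting two
simplices `σ ⊂ τ`, where `σ` is a free face of `τ`, that is, `τ` is the only simplex of `K` that
properly contains `σ`. -/
def ElementaryCollapse (K L : PreAbstractSimplicialComplex V) : Prop :=
  ∃ σ ∈ K.faces, ∃ τ ∈ K.faces, σ ⊂ τ ∧ (∀ ρ ∈ K.faces, σ ⊂ ρ → ρ = τ) ∧
    L.faces = K.faces \ {σ, τ}

/-- `K` collapses to `L` if finitely many elementary collapses lead from `K` to `L`. -/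
def CollapsesTo (K L : PreAbstractSimplicialComplex V) : Prop :=
  Relation.ReflTransGen ElementaryCollapse K L

/-- A complex is collapsible if it collapses to a single vertex. -/
def IsCollapsible (K : PreAbstractSimplicialComplex V) : Prop :=
  ∃ (L : PreAbstractSimplicialComplex V) (v : V), L.faces = {{v}} ∧ CollapsesTo K L

end Collapse

/-! ### Simplicial complexes as inputs of algorithms -/

/-- A finite simplicial complex as it is handed to an algorithm: the vertices are
`0, …, numVertices - 1`, and the simplices are listed without repetition, in any order. -/
structure ComplexInput where
  /-- the number of vertices -/
  numVertices : ℕ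
  /-- the simplicial complex; every element of `Fin numVertices` is a vertex -/
  complex : AbstractSimplicialComplex (Fin numVertices)
  /-- the list of its simplices -/
  simplices : List (Finset (Fin numVertices))
  nodup_simplices : simplices.Nodup
  mem_simplices : ∀ s, s ∈ simplices ↔ s ∈ complex.faces

/-- The word over the alphabet `{0, 1, separator}` (the separator is `none`) that writes a list of
bit strings, each one followed by a separator. -/
def encodeRows (l : List (List Bool)) : List (Option Bool) :=
  l.flatMap fun r => r.map some ++ [none]

/-- A set of vertices as a bit string of length `m`. -/
def vertexRow {m : ℕ} (s : Finset (Fin m)) : List Bool :=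
  List.ofFn fun i : Fin m => decide (i ∈ s)

namespace ComplexInput

/-- The number of simplices. -/
def size (K : ComplexInput) : ℕ := K.simplices.length

/-- The input word: the simplices one after the other, each written as a bit string of length
`numVertices`. If there are `n` simplices then its length is between `n` and `n * (n + 1)`. -/
def encode (K : ComplexInput) : List (Option Bool) :=
  encodeRows (K.simplices.map vertexRow)

/-- The output word for a list of pairs of simplices: for each pair the two bit strings. -/
def encodePairs (K : ComplexInput) (M : List (FacePoset K.complex × FacePoset K.complex)) :
    List (Option Bool) :=
  encodeRows (M.flatMap fun p => [vertexRow p.1.1, vertexRow p.2.1])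

end ComplexInput

theorem encodeRows_injective : Function.Injective encodeRows := by
  have key : ∀ (r r' : List Bool) (t t' : List (Option Bool)),
      r.map some ++ none :: t = r'.map some ++ none :: t' → r = r' ∧ t = t' := by
    intro r
    induction r with
    | nil =>
      intro r' t t' h
      cases r' with
      | nil => simpa using h
      | cons b r' => simp at h
    | cons a r ih =>
      intro r' t t' h
      cases r' with
      | nil => simp at h
      | cons b r' =>
        simp only [List.map_cons, List.cons_append, List.cons.injEq, Option.some.injEq] at h
        obtain ⟨h1, h2⟩ := ih r' t t' h.2
        exact ⟨by rw [h.1, h1], h2⟩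
  intro l
  induction l with
  | nil =>
    intro l' h
    cases l' with
    | nil => rfl
    | cons r l' => simp [encodeRows] at h
  | cons r l ih =>
    intro l' h
    cases l' with
    | nil => simp [encodeRows] at h
    | cons r' l' =>
      simp only [encodeRows, List.flatMap_cons, List.append_assoc, List.singleton_append] at h
      obtain ⟨h1, h2⟩ := key _ _ _ _ h
      rw [h1, ih h2]

theorem vertexRow_injective {m : ℕ} : Function.Injective (vertexRow (m := m)) := by
  intro s t h
  ext i
  have := congrFun (List.ofFn_injective h) i
  simpa using this

/-- Different inputs have different input words. -/
theorem ComplexInput.encode_injective : Function.Injective ComplexInput.encode := by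
  rintro ⟨m, K, l, hl, hK⟩ ⟨m', K', l', hl', hK'⟩ h
  have h1 : l.map vertexRow = l'.map vertexRow := encodeRows_injective h
  have hm : m = m' := by
    cases l with
    | nil =>
      cases l' with
      | nil =>
        have e : ∀ (k : ℕ) (L : AbstractSimplicialComplex (Fin k)),
            (∀ s, s ∈ ([] : List (Finset (Fin k))) ↔ s ∈ L.faces) → k = 0 := by
          intro k L hL
          by_contra hk
          have := (hL _).2 (L.singleton_mem ⟨0, Nat.pos_of_ne_zero hk⟩)
          simp at this
        rw [e m K hK, e m' K' hK']
      | cons s' l' => simp at h1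
    | cons s l =>
      cases l' with
      | nil => simp at h1
      | cons s' l' =>
        have := congrArg List.length (List.cons.inj h1).1
        simpa [vertexRow] using this
  subst hm
  obtain rfl : l = l' := List.map_injective_iff.2 vertexRow_injective h1
  obtain rfl : K = K' := by
    ext s
    rw [← hK, ← hK']
  rfl

/-- For a fixed complex, different lists of pairs have different output words. -/
theorem ComplexInput.encodePairs_injective (K : ComplexInput) :
    Function.Injective K.encodePairs := by
  intro M M' h
  have h1 := encodeRows_injective h
  clear h
  induction M generalizing M' with
  | nil =>
    cases M' with
    | nil => rfl
    | cons q M' => simp at h1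
  | cons p M ih =>
    cases M' with
    | nil => simp at h1
    | cons q M' =>
      simp only [List.flatMap_cons, List.cons_append, List.nil_append, List.cons.injEq] at h1
      obtain ⟨h2, h3, h4⟩ := h1
      have e : p = q := Prod.ext (Subtype.ext (vertexRow_injective h2))
        (Subtype.ext (vertexRow_injective h3))
      rw [e, ih h4]

/-! ### The two computational problems -/

/-- An input-output map of an algorithm for the Min-Morse matching problem: it assigns to each
complex a list of pairs of simplices. -/
abbrev MatchingMap : Type :=
  (K : ComplexInput) → List (FacePoset K.complex × FacePoset K.complex)

/-- The set of pairs in the list that is returned for `K`. -/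
def MatchingMap.output (A : MatchingMap) (K : ComplexInput) :
    Set (FacePoset K.complex × FacePoset K.complex) :=
  {p | p ∈ A K}

/-- The map is computed by a (multi-stack) Turing machine in time polynomial in the length of the
input word. -/
def MatchingMap.IsPolyTime (A : MatchingMap) : Prop :=
  Nonempty (Turing.TM2ComputableInPolyTime ComplexInput.encode (id : List (Option Bool) → _)
    (fun K : ComplexInput => K.encodePairs (A K)))

/-- `A` is (the input-output map of) an `α`-approximation algorithm for the Min-Morse matching
problem: it runs in polynomial time, and for each complex it returns a Morse matching, listed
without repetition, whose number of critical simplices is at most `α n` times that of any Morse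
matching (equivalently, of an optimal one), where `n` is the number of simplices. -/
def IsMinMMApproximation (α : ℕ → ℝ) (A : MatchingMap) : Prop :=
  A.IsPolyTime ∧
    ∀ K : ComplexInput, (A K).Nodup ∧ IsMorseMatching K.complex (A.output K) ∧
      ∀ M, IsMorseMatching K.complex M →
        (numCritical K.complex (A.output K) : ℝ) ≤ α K.size * numCritical K.complex M

open Classical in
/-- A Turing machine decides in polynomial time whether a given simplicial complex is
collapsible. -/
def CollapsibilityIsPolyTime : Prop :=
  Nonempty (Turing.TM2ComputableInPolyTime ComplexInput.encode Computability.encodeBool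
    (fun K : ComplexInput => decide (IsCollapsible K.complex.toPreAbstractSimplicialComplex)))

/-! ### The amplified complex -/

section Wedge

variable {V : Type*} [DecidableEq V]

/-- The vertices of the wedge of `N` copies of a complex on `V` with base vertex `v`: the common
base vertex `none`, and `N` copies of each other vertex. -/
abbrev WedgeVertex (N : ℕ) (v : V) : Type _ := Option (Fin N × {w : V // w ≠ v})

/-- The inclusion of the `i`-th copy of the vertices. -/
def wedgeInclusion (N : ℕ) (v : V) (i : Fin N) (w : V) : WedgeVertex N v :=
  if h : w = v then none else some (i, ⟨w, h⟩)

/-- The wedge of `N` copies of `K` at the base vertex `v`: the union of the `N` copies. -/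
def wedge (K : AbstractSimplicialComplex V) (N : ℕ) (v : V) :
    PreAbstractSimplicialComplex (WedgeVertex N v) :=
  ⨆ i : Fin N, K.toPreAbstractSimplicialComplex.map (wedgeInclusion N v i)

end Wedge

/-- `Q` is, up to the names of the vertices and the order in which the simplices are listed, the
amplified complex of `K` with base vertex `v` and exponent `c`, that is, the wedge at `v` of
`n ^ (c - 1)` copies of `K`, where `n` is the number of simplices of `K`. -/
def IsAmplifiedComplex (K : ComplexInput) (v : Fin K.numVertices) (c : ℕ) (Q : ComplexInput) :
    Prop :=
  ∃ e : WedgeVertex (K.size ^ (c - 1)) v ≃ Fin Q.numVertices,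
    Q.complex.toPreAbstractSimplicialComplex = (wedge K.complex (K.size ^ (c - 1)) v).map e

/-! ### Acyclic matchings on families of finite sets -/

/-! A complex collapses to a vertex exactly when it has an acyclic matching whose only critical
simplex is a vertex, and this vertex can then be prescribed. In one direction the collapsing pairs
are added to the matching in reverse order (`CollapsesTo.exists_morseOn`). In the other, some pair
of the matching has a free lower member: otherwise the mate of each top-dimensional simplex would
lie in a second one, and iterating this would close a cycle. Deleting such a pair is an elementary
collapse, and induction finishes the argument (`MorseOn.isCollapsible`).

The wedge turns this into a gap. If `K` is collapsible, take a matching critical only at the base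
vertex; its copies fit together to a matching of the wedge with at most one critical simplex
(`MorseOn.wedge`). Conversely, if a matching of the wedge has fewer critical simplices than there
are copies, some copy contains none except possibly the base vertex, and the restriction to this
copy shows that `K` is collapsible (`MorseOn.exists_copy`). The wedge has at most `n ^ c` simplices.
For collapsible `K` the approximation guarantee is thus at most `p * n ^ (c * (1 - ε))`, which is
below `n ^ (c - 1)` as soon as `n ^ (c * ε - 1)` exceeds `p`; the choice of `c` makes this exponent
positive (`approximation_lt`, `isCollapsible_iff_numCritical_lt`).

What remains is to realize this test by a Turing machine in polynomial time. Stack programs are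
built from fragments whose specifications, with time bounds, compose. The decision program counts
the simplices, computes the number of copies in unary, writes the input word of the wedge at vertex
`0`, runs the given machine on it as a subroutine, and compares two counters. It never decodes the
matching: each pair fills two rows of the output, so the number of critical simplices is the number
of rows written minus the number of separators returned (`numCritical_add`,
`count_none_encodePairs`). The criterion holds only above a size threshold; the finitely many
shorter input words are answered from a table built into the control (`Program.lookup`). All
parameters are bounded by polynomials in the input length. -/

section RawMatchings

variable {V : Type*}

/-- `M` is an acyclic partial matching of the Hasse diagram of the finite sets, all of whose pairs
consist of members of `F`. -/
structure MorseOn (F : Set (Finset V)) (M : Set (Finset V × Finset V)) : Prop where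
  mem : ∀ p ∈ M, p.1 ∈ F ∧ p.2 ∈ F
  matching : IsPartialMatching M
  acyclic : IsAcyclicMatching M

/-- The members of `F` that belong to no pair of `M`. -/
def unmatched (F : Set (Finset V)) (M : Set (Finset V × Finset V)) : Set (Finset V) :=
  {s ∈ F | ∀ p ∈ M, s ≠ p.1 ∧ s ≠ p.2}

theorem IsPartialMatching.mono {P : Type*} [PartialOrder P] {M M' : Set (P × P)}
    (h : IsPartialMatching M) (hM : M' ⊆ M) : IsPartialMatching M' :=
  ⟨fun p hp => h.1 p (hM hp), fun x p hp q hq => h.2 x p (hM hp) q (hM hq)⟩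

theorem IsAcyclicMatching.mono {P : Type*} [PartialOrder P] {M M' : Set (P × P)}
    (h : IsAcyclicMatching M) (hM : M' ⊆ M) : IsAcyclicMatching M' := by
  rintro ⟨n, hn, a, b, hb, hab⟩
  exact h ⟨n, hn, a, b, hb, fun i => ⟨hM (hab i).1, (hab i).2⟩⟩

/-- A self-map without fixed points has an injective cycle in each nonempty finite invariant set,
indexed so that it runs backwards. -/
theorem exists_backward_cycle {X : Type*} [Finite X] [Nonempty X] (f : X → X)
    (hf : ∀ x, f x ≠ x) :
    ∃ n : ℕ, 2 ≤ n ∧ ∃ b : ZMod n → X, Function.Injective b ∧ ∀ i, b i = f (b (i + 1)) := by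
  obtain ⟨x, k, hk, hx⟩ : ∃ x : X, ∃ k, 0 < k ∧ f^[k] x = x := by
    obtain ⟨x⟩ := ‹Nonempty X›
    obtain ⟨i, j, hij, h⟩ := Finite.exists_ne_map_eq_of_infinite (fun k : ℕ => f^[k] x)
    wlog hlt : i < j generalizing i j
    · exact this j i hij.symm h.symm (by omega)
    refine ⟨f^[i] x, j - i, by omega, ?_⟩
    rw [← Function.iterate_add_apply, Nat.sub_add_cancel hlt.le]
    exact h.symm
  have hper : x ∈ Function.periodicPts f := Function.mk_mem_periodicPts hk hx
  have hpos := Function.minimalPeriod_pos_of_mem_periodicPts hper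
  have hne1 : Function.minimalPeriod f x ≠ 1 := fun h =>
    hf x (Function.minimalPeriod_eq_one_iff_isFixedPt.1 h)
  set n := Function.minimalPeriod f x with hn
  have : NeZero n := ⟨hpos.ne'⟩
  -- The sign runs through the orbit backwards, because a Morse cycle requires `a (i + 1)` to lie
  -- below `b i`.
  refine ⟨n, by omega, fun i => f^[(-i).val] x, ?_, ?_⟩
  · intro i j hij
    have := Function.iterate_injOn_Iio_minimalPeriod (f := f) (x := x)
      (ZMod.val_lt (-i)) (ZMod.val_lt (-j)) hij
    exact neg_injective (ZMod.val_injective n this)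
  · intro i
    have h1 : (-i) = (-(i + 1)) + 1 := by ring
    have h2 : (-i).val = ((-(i + 1)).val + 1) % n := by
      conv_lhs => rw [h1, ZMod.val_add, ZMod.val_one'' hne1]
    show f^[(-i).val] x = f (f^[(-(i + 1)).val] x)
    rw [← Function.iterate_succ_apply' f, h2]
    exact Function.iterate_mod_minimalPeriod_eq

end RawMatchings

/-! ### Collapses and acyclic matchings -/

section Collapsing

variable {V : Type*}

theorem PreAbstractSimplicialComplex.nonempty_of_mem (K : PreAbstractSimplicialComplex V)
    {s : Finset V} (hs : s ∈ K.faces) : s.Nonempty :=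
  (K.isRelLowerSet_faces hs).1

theorem PreAbstractSimplicialComplex.mem_of_subset (K : PreAbstractSimplicialComplex V)
    {s t : Finset V} (hs : s ∈ K.faces) (h : t ⊆ s) (ht : t.Nonempty) : t ∈ K.faces :=
  (K.isRelLowerSet_faces hs).2 h ht

/-- The complex that remains when a free face and its coface are deleted. -/
def PreAbstractSimplicialComplex.deletePair (K : PreAbstractSimplicialComplex V) (σ τ : Finset V)
    (h : σ ⊂ τ) (hfree : ∀ ρ ∈ K.faces, σ ⊂ ρ → ρ = τ) : PreAbstractSimplicialComplex V where
  faces := K.faces \ {σ, τ}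
  isRelLowerSet_faces := by
    rintro s ⟨hs, hne⟩
    simp only [Set.mem_insert_iff, Set.mem_singleton_iff, not_or] at hne
    refine ⟨K.nonempty_of_mem hs, fun t ht htne => ⟨K.mem_of_subset hs ht htne, ?_⟩⟩
    simp only [Set.mem_insert_iff, Set.mem_singleton_iff, not_or]
    constructor
    · rintro rfl
      exact hne.2 (hfree s hs (lt_of_le_of_ne ht (Ne.symm hne.1)))
    · rintro rfl
      exact hne.2 (hfree s hs (h.trans_le ht))

theorem card_of_covBy [DecidableEq V] {s t : Finset V} (h : s ⋖ t) : t.card = s.card + 1 := by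
  obtain ⟨a, ha, rfl⟩ := Finset.covBy_iff_exists_insert.1 h
  exact Finset.card_insert_of_notMem ha

theorem covBy_of_subset_of_card [DecidableEq V] {s t : Finset V} (h : s ⊆ t) (hc : t.card = s.card + 1) :
    s ⋖ t := by
  rw [Finset.covBy_iff_card_sdiff_eq_one]
  exact ⟨h, by rw [Finset.card_sdiff_of_subset h]; omega⟩

/-- The top-dimensional simplices of a matched complex of positive dimension cannot all be matched
with non-free faces. -/
theorem MorseOn.exists_free_pair [DecidableEq V] {K : PreAbstractSimplicialComplex V} (hfin : K.faces.Finite)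
    {M : Set (Finset V × Finset V)} (hM : MorseOn K.faces M) {v : V}
    (hcrit : unmatched K.faces M ⊆ {{v}}) (hbig : ∃ s ∈ K.faces, 2 ≤ s.card) :
    ∃ p ∈ M, ∀ ρ ∈ K.faces, p.1 ⊂ ρ → ρ = p.2 := by
  obtain ⟨s₀, hs₀, hs₀c⟩ := hbig
  obtain ⟨top, htop, hmax⟩ := hfin.exists_maximalFor Finset.card _ ⟨s₀, hs₀⟩
  have hle : ∀ s ∈ K.faces, s.card ≤ top.card := fun s hs => by
    by_contra h
    exact h (hmax hs (by omega))
  have htop2 : 2 ≤ top.card := hs₀c.trans (hle _ hs₀)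
  let D : Set (Finset V) := {s ∈ K.faces | s.card = top.card}
  -- A top simplex has at least two vertices, so it is not the critical one, and it is too large to
  -- be the lower member of a pair.
  have hmate : ∀ s : D, ∃ a, (a, s.1) ∈ M := by
    rintro ⟨s, hs, hsc⟩
    have hnot : s ∉ unmatched K.faces M := fun h => by
      have : s = {v} := hcrit h
      rw [this, Finset.card_singleton] at hsc
      omega
    have : ∃ p ∈ M, s = p.1 ∨ s = p.2 := by
      by_contra hcon
      push Not at hcon
      exact hnot ⟨hs, hcon⟩
    obtain ⟨p, hp, h | h⟩ := this
    · have h1 := card_of_covBy (hM.matching.1 p hp)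
      have h2 := hle _ (hM.mem p hp).2
      rw [← h] at h1
      omega
    · exact ⟨p.1, by subst h; exact hp⟩
  by_contra hcon
  push Not at hcon
  choose g hg using hmate
  -- If no pair is free, the mate of `s` lies in another simplex, which by maximality is again of
  -- top dimension. This gives a self-map of `D` without fixed points.
  have hnext : ∀ s : D, ∃ ρ : D, ρ ≠ s ∧ g s ⋖ ρ.1 := by
    intro s
    obtain ⟨ρ, hρ, hsub, hne⟩ := hcon _ (hg s)
    have h1 : s.1.card = (g s).card + 1 := card_of_covBy (hM.matching.1 _ (hg s))
    have h2 := Finset.card_lt_card hsub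
    have h3 := hle ρ hρ
    have h4 := s.2.2
    simp only at h1 h2
    have h5 : ρ.card = top.card := by omega
    refine ⟨⟨ρ, hρ, h5⟩, fun h => hne (congrArg Subtype.val h), ?_⟩
    exact covBy_of_subset_of_card hsub.1 (show ρ.card = _ by omega)
  choose f hf hcov using hnext
  have : Finite D := (hfin.subset fun s hs => hs.1).to_subtype
  have : Nonempty D := ⟨⟨top, htop, rfl⟩⟩
  obtain ⟨n, hn, b, hb, hstep⟩ := exists_backward_cycle f hf
  refine hM.acyclic ⟨n, hn, fun i => g (b i), fun i => (b i).1,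
    Subtype.val_injective.comp hb, fun i => ⟨hg _, hM.matching.1 _ (hg _), ?_⟩⟩
  have := hcov (b (i + 1))
  rwa [← hstep i] at this

/-- A complex with an acyclic matching all of whose critical simplices equal one vertex is
collapsible. -/
theorem MorseOn.isCollapsible [DecidableEq V] {K : PreAbstractSimplicialComplex V} (hfin : K.faces.Finite)
    (hne : K.faces.Nonempty) {M : Set (Finset V × Finset V)} (hM : MorseOn K.faces M) {v : V}
    (hcrit : unmatched K.faces M ⊆ {{v}}) : IsCollapsible K := by
  induction h : K.faces.ncard using Nat.strong_induction_on generalizing K M with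
  | _ n ih =>
  by_cases hbig : ∃ s ∈ K.faces, 2 ≤ s.card
  · obtain ⟨p, hp, hfree⟩ := hM.exists_free_pair hfin hcrit hbig
    have hcov := hM.matching.1 p hp
    have hc := card_of_covBy hcov
    have hmem := hM.mem p hp
    let L := K.deletePair p.1 p.2 hcov.lt hfree
    have hLF : L.faces = K.faces \ {p.1, p.2} := rfl
    have hLK : L.faces ⊆ K.faces := Set.sdiff_subset
    have hlt : L.faces.ncard < n := by
      rw [← h]
      refine Set.ncard_lt_ncard ⟨hLK, fun hsub => ?_⟩ hfin
      exact (hsub hmem.1).2 (by simp)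
    have hother : ∀ q ∈ M, q ≠ p → ∀ x, (x = q.1 ∨ x = q.2) → x ≠ p.1 ∧ x ≠ p.2 := by
      intro q hq hqp x hx
      constructor <;> rintro rfl
      · exact hqp (hM.matching.2 _ q hq p hp hx (Or.inl rfl))
      · exact hqp (hM.matching.2 _ q hq p hp hx (Or.inr rfl))
    have hM' : MorseOn L.faces (M \ {p}) := by
      refine ⟨fun q hq => ?_, hM.matching.mono Set.sdiff_subset, hM.acyclic.mono Set.sdiff_subset⟩
      have h1 := hother q hq.1 hq.2 q.1 (Or.inl rfl)
      have h2 := hother q hq.1 hq.2 q.2 (Or.inr rfl)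
      have h3 := hM.mem q hq.1
      simp only [hLF, Set.mem_sdiff, Set.mem_insert_iff, Set.mem_singleton_iff, not_or]
      exact ⟨⟨h3.1, h1⟩, h3.2, h2⟩
    have hcrit' : unmatched L.faces (M \ {p}) ⊆ {{v}} := by
      rintro s ⟨⟨hs, hs'⟩, hsM⟩
      refine hcrit ⟨hs, fun q hq => ?_⟩
      by_cases hqp : q = p
      · subst hqp
        simpa using hs'
      · exact hsM q ⟨hq, hqp⟩
    -- A second facet of the larger simplex survives, so the complex never becomes empty. This is
    -- why it suffices that the critical set is contained in `{{v}}`.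
    have hneL : L.faces.Nonempty := by
      obtain ⟨x, hx⟩ := K.nonempty_of_mem hmem.1
      have hxp : x ∈ p.2 := hcov.le hx
      have hcard : (p.2.erase x).card = p.1.card := by
        rw [Finset.card_erase_of_mem hxp]; omega
      refine ⟨p.2.erase x, K.mem_of_subset hmem.2 (Finset.erase_subset _ _) ?_, ?_⟩
      · rw [← Finset.card_pos, hcard, Finset.card_pos]
        exact ⟨x, hx⟩
      · simp only [Set.mem_insert_iff, Set.mem_singleton_iff, not_or]
        exact ⟨fun he => Finset.notMem_erase x p.2 (he ▸ hx),
          fun he => Finset.notMem_erase x p.2 (by rw [he]; exact hxp)⟩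
    obtain ⟨L', w, hw, hcol⟩ := ih _ hlt (hfin.subset hLK) hneL hM' hcrit' rfl
    exact ⟨L', w, hw, Relation.ReflTransGen.head
      ⟨p.1, hmem.1, p.2, hmem.2, hcov.lt, hfree, rfl⟩ hcol⟩
  · push Not at hbig
    -- The upper member of a pair has at least two vertices, so here the matching is empty and every
    -- simplex is critical.
    have hall : K.faces ⊆ {{v}} := by
      intro s hs
      refine hcrit ⟨hs, fun q hq => ?_⟩
      have h1 := card_of_covBy (hM.matching.1 q hq)
      have h2 := hbig _ (hM.mem q hq).2
      have h3 := Finset.card_pos.2 (K.nonempty_of_mem (hM.mem q hq).1)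
      omega
    refine ⟨K, v, ?_, Relation.ReflTransGen.refl⟩
    exact (Set.subset_singleton_iff_eq.1 hall).resolve_left hne.ne_empty

/-- Adding a pair `(a, τ)` of unmatched sets keeps a matching acyclic if `a` has no coface in the
old family, or `τ` has no other facet in it. -/
theorem MorseOn.insert_pair {F F' : Set (Finset V)} {M : Set (Finset V × Finset V)}
    (hM : MorseOn F M) (hF : F ⊆ F') {a τ : Finset V} (ha : a ∈ F') (hτ : τ ∈ F') (hτF : τ ∉ F)
    (hcov : a ⋖ τ) (haM : ∀ p ∈ M, a ≠ p.1 ∧ a ≠ p.2)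
    (h : (∀ ρ ∈ F, ¬ a ⋖ ρ) ∨ ∀ c ∈ F, c ⋖ τ → c = a) : MorseOn F' (insert (a, τ) M) := by
  have hτM : ∀ p ∈ M, τ ≠ p.1 ∧ τ ≠ p.2 := fun p hp =>
    ⟨fun e => hτF (e ▸ (hM.mem p hp).1), fun e => hτF (e ▸ (hM.mem p hp).2)⟩
  have hmatch : IsPartialMatching (insert (a, τ) M) := by
    constructor
    · rintro p (rfl | hp)
      · exact hcov
      · exact hM.matching.1 p hp
    · rintro x p (rfl | hp) q (rfl | hq) hxp hxq
      · rfl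
      · rcases hxp with rfl | rfl
        · exact absurd hxq (not_or.2 (haM q hq))
        · exact absurd hxq (not_or.2 (hτM q hq))
      · rcases hxq with rfl | rfl
        · exact absurd hxp (not_or.2 (haM p hp))
        · exact absurd hxp (not_or.2 (hτM p hp))
      · exact hM.matching.2 x p hp q hq hxp hxq
  refine ⟨?_, hmatch, ?_⟩
  · rintro p (rfl | hp)
    · exact ⟨ha, hτ⟩
    · exact ⟨hF (hM.mem p hp).1, hF (hM.mem p hp).2⟩
  · rintro ⟨n, hn, a', b', hb', hab⟩
    by_cases hex : ∃ i, b' i = τ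
    · obtain ⟨i, hi⟩ := hex
      -- A cycle has length at least two and its upper members are distinct, so the neighbours of
      -- `τ` in the cycle belong to old pairs.
      have : Fact (1 < n) := ⟨hn⟩
      have hnext : b' (i + 1) ≠ τ := fun e => by
        have := hb' (e.trans hi.symm)
        simp at this
      have hprev : b' (i - 1) ≠ τ := fun e => by
        have := hb' (e.trans hi.symm)
        simp at this
      have old : ∀ j, b' j ≠ τ → (a' j, b' j) ∈ M := fun j hj => by
        rcases (hab j).1 with e | hmem
        · exact absurd (congrArg Prod.snd e) hj
        · exact hmem
      have hai : a' i = a := by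
        rcases (hab i).1 with e | hmem
        · exact congrArg Prod.fst e
        · exact absurd hi.symm (hτM _ hmem).2
      -- The pair before `τ` would supply an old coface of `a`. The pair after it would supply an
      -- old facet of `τ`, which would have to be `a` although `a` is unmatched in `M`.
      rcases h with h | h
      · refine h _ (hM.mem _ (old _ hprev)).2 ?_
        have := (hab (i - 1)).2.2
        rwa [sub_add_cancel, hai] at this
      · have h1 := (hab i).2.2
        rw [hi] at h1
        have h2 := h _ (hM.mem _ (old _ hnext)).1 h1
        exact (haM _ (old _ hnext)).1 h2.symm
    · push Not at hex
      refine hM.acyclic ⟨n, hn, a', b', hb', fun i => ⟨?_, (hab i).2⟩⟩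
      rcases (hab i).1 with e | hmem
      · exact absurd (congrArg Prod.snd e) (hex i)
      · exact hmem

theorem unmatched_insert_eq {F' : Set (Finset V)} {M : Set (Finset V × Finset V)}
    {a τ : Finset V} {S : Set (Finset V)}
    (h : ∀ s, (s ∈ F' ∧ s ≠ a ∧ s ≠ τ ∧ ∀ p ∈ M, s ≠ p.1 ∧ s ≠ p.2) ↔ s ∈ S) :
    unmatched F' (insert (a, τ) M) = S := by
  ext s
  rw [← h s]
  simp only [unmatched, Set.mem_ofPred_eq, Set.mem_insert_iff, forall_eq_or_imp]
  tauto

/-- A complex that collapses to a vertex has, for each of its vertices, an acyclic matching with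
this vertex as the only critical simplex. -/
theorem CollapsesTo.exists_morseOn [DecidableEq V] {K L : PreAbstractSimplicialComplex V} (h : CollapsesTo K L)
    {w : V} (hL : L.faces = {{w}}) {v : V} (hv : {v} ∈ K.faces) :
    ∃ M, MorseOn K.faces M ∧ unmatched K.faces M = {{v}} := by
  -- The vertex varies because a collapse may remove `v`; the smaller complex is then used with
  -- another critical vertex.
  induction h using Relation.ReflTransGen.head_induction_on generalizing v with
  | refl =>
    rw [hL] at hv ⊢
    refine ⟨∅, ⟨by simp, ⟨by simp, by simp⟩, ?_⟩, ?_⟩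
    · rintro ⟨n, -, a, b, -, hab⟩
      exact (hab 0).1
    · rw [hv]
      simp [unmatched]
  | @head K K₁ hstep _ ih =>
    obtain ⟨σ, hσ, τ, hτ, hlt, hfree, hfaces⟩ := hstep
    have hmem₁ : ∀ s, s ∈ K₁.faces ↔ s ∈ K.faces ∧ s ≠ σ ∧ s ≠ τ := fun s => by
      rw [hfaces]; simp
    have hsub : K₁.faces ⊆ K.faces := fun s hs => ((hmem₁ s).1 hs).1
    have hσ₁ : σ ∉ K₁.faces := fun hs => ((hmem₁ _).1 hs).2.1 rfl
    have hτ₁ : τ ∉ K₁.faces := fun hs => ((hmem₁ _).1 hs).2.2 rfl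
    -- Freeness forces codimension one: adding a single vertex of `τ` to `σ` already gives a proper
    -- coface.
    have hcov : σ ⋖ τ := by
      obtain ⟨x, hxτ, hxσ⟩ := Finset.exists_of_ssubset hlt
      have : insert x σ = τ := hfree _ (K.mem_of_subset hτ
        (Finset.insert_subset hxτ hlt.1) (Finset.insert_nonempty _ _)) (Finset.ssubset_insert hxσ)
      rw [← this]
      exact Finset.covBy_insert hxσ
    have hcard := card_of_covBy hcov
    have hσpos := Finset.card_pos.2 (K.nonempty_of_mem hσ)
    have hvτ : {v} ≠ τ := by
      rintro rfl
      rw [Finset.card_singleton] at hcard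
      omega
    by_cases hvσ : {v} = σ
    -- The collapse removes `v` with an edge `{u, v}`. The roles of the ends are exchanged: `u` is
    -- critical for the smaller complex and is now matched with the edge, leaving `v` critical. This
    -- creates no cycle since the other facet `{v}` is absent from `K₁`.
    · subst hvσ
      obtain ⟨u, hu, rfl⟩ := Finset.covBy_iff_exists_insert.1 hcov
      have huv : u ≠ v := by simpa using hu
      have hu₁ : {u} ∈ K₁.faces := by
        refine (hmem₁ _).2 ⟨K.mem_of_subset hτ (by simp) (by simp), by simpa using huv, ?_⟩
        intro e
        have := congrArg Finset.card e
        rw [hcard] at this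
        simp at this
      obtain ⟨M, hM, hcrit⟩ := ih hu₁
      have huM : {u} ∈ unmatched K₁.faces M := by rw [hcrit]; rfl
      have hcovu : {u} ⋖ insert u ({v} : Finset V) :=
        covBy_of_subset_of_card (by simp) (by rw [hcard]; simp)
      refine ⟨_, hM.insert_pair hsub (hsub hu₁) hτ hτ₁ hcovu huM.2 (Or.inr ?_), ?_⟩
      · intro c hc hcτ
        have h1 := card_of_covBy hcτ
        rw [hcard, Finset.card_singleton] at h1
        obtain ⟨x, rfl⟩ := Finset.card_eq_one.1 (by omega : c.card = 1)
        have hx : x ∈ insert u ({v} : Finset V) := hcτ.le (Finset.mem_singleton_self x)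
        rcases Finset.mem_insert.1 hx with rfl | hx
        · rfl
        · rw [Finset.mem_singleton.1 hx] at hc
          exact absurd hc hσ₁
      · refine unmatched_insert_eq fun s => ?_
        constructor
        · rintro ⟨hs, hsu, hsτ, hsM⟩
          by_contra hsv
          have : s ∈ unmatched K₁.faces M := ⟨(hmem₁ s).2 ⟨hs, hsv, hsτ⟩, hsM⟩
          rw [hcrit] at this
          exact hsu this
        · rintro rfl
          exact ⟨hv, by simpa using huv.symm, hvτ, fun p hp =>
            ⟨fun e => hσ₁ (e ▸ (hM.mem p hp).1), fun e => hσ₁ (e ▸ (hM.mem p hp).2)⟩⟩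
    · obtain ⟨M, hM, hcrit⟩ := ih ((hmem₁ _).2 ⟨hv, hvσ, hvτ⟩)
      have hvM : {v} ∈ unmatched K₁.faces M := by rw [hcrit]; rfl
      refine ⟨_, hM.insert_pair hsub hσ hτ hτ₁ hcov (fun p hp =>
        ⟨fun e => hσ₁ (e ▸ (hM.mem p hp).1), fun e => hσ₁ (e ▸ (hM.mem p hp).2)⟩)
        (Or.inl fun ρ hρ hc => hτ₁ (hfree ρ (hsub hρ) hc.lt ▸ hρ)), ?_⟩
      refine unmatched_insert_eq fun s => ?_
      constructor
      · rintro ⟨hs, hsσ, hsτ, hsM⟩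
        rw [← hcrit]
        exact ⟨(hmem₁ s).2 ⟨hs, hsσ, hsτ⟩, hsM⟩
      · rintro rfl
        exact ⟨hv, hvσ, hvτ, hvM.2⟩

end Collapsing

/-! ### Matchings of a wedge -/

section WedgeMatchings

variable {ι V W : Type*} [DecidableEq V] [DecidableEq W]

/-- The maps `φ i` are embeddings of one set into another, which agree at `v` and whose images
are otherwise disjoint. -/
structure IsWedgeFamily (φ : ι → V → W) (v : V) : Prop where
  injective : ∀ i, Function.Injective (φ i)
  base : ∀ i j, φ i v = φ j v
  disjoint : ∀ i j x y, φ i x = φ j y → x ≠ v → i = j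

/-- The images of the members of `F` under the maps `φ i`. -/
def wedgeFaces (φ : ι → V → W) (F : Set (Finset V)) : Set (Finset W) :=
  {t | ∃ i, ∃ s ∈ F, s.image (φ i) = t}

theorem image_covBy_image_iff {f : V → W} (hf : Function.Injective f) {s t : Finset V} :
    s.image f ⋖ t.image f ↔ s ⋖ t := by
  constructor
  · intro h
    have hc := card_of_covBy h
    rw [Finset.card_image_of_injective _ hf, Finset.card_image_of_injective _ hf] at hc
    exact covBy_of_subset_of_card ((Finset.image_subset_image_iff hf).1 h.le) hc
  · intro h
    refine covBy_of_subset_of_card (Finset.image_subset_image h.le) ?_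
    rw [Finset.card_image_of_injective _ hf, Finset.card_image_of_injective _ hf]
    exact card_of_covBy h

theorem exists_ne_of_ne_singleton {s : Finset V} {v : V} (hs : s.Nonempty) (h : s ≠ {v}) :
    ∃ x ∈ s, x ≠ v := by
  by_contra hcon
  push Not at hcon
  exact h (Finset.eq_singleton_iff_nonempty_unique_mem.2 ⟨hs, hcon⟩)

variable {φ : ι → V → W} {v : V}

/-- A simplex other than the base vertex has a vertex that occurs in one copy only, so it determines
the copy of every simplex containing it. -/
theorem IsWedgeFamily.index_eq (hφ : IsWedgeFamily φ v) {i j : ι} {s t : Finset V}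
    (hs : s.Nonempty) (hsv : s ≠ {v}) (h : s.image (φ i) ⊆ t.image (φ j)) : i = j := by
  obtain ⟨x, hx, hxv⟩ := exists_ne_of_ne_singleton hs hsv
  obtain ⟨y, -, hy⟩ := Finset.mem_image.1 (h (Finset.mem_image_of_mem _ hx))
  exact hφ.disjoint i j x y hy.symm hxv

theorem IsWedgeFamily.eq_of_image_eq (hφ : IsWedgeFamily φ v) {i j : ι} {s t : Finset V}
    (hs : s.Nonempty) (hsv : s ≠ {v}) (h : s.image (φ i) = t.image (φ j)) : i = j ∧ s = t := by
  obtain rfl := hφ.index_eq hs hsv h.le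
  exact ⟨rfl, Finset.image_injective (hφ.injective _) h⟩

/-- A matching whose only critical simplex is the base vertex extends to all copies. -/
theorem MorseOn.wedge (hφ : IsWedgeFamily φ v) {F : Set (Finset V)} (hF : ∀ s ∈ F, s.Nonempty)
    {M : Set (Finset V × Finset V)} (hM : MorseOn F M) (hcrit : unmatched F M = {{v}}) :
    ∃ M', MorseOn (wedgeFaces φ F) M' ∧ (unmatched (wedgeFaces φ F) M').Subsingleton := by
  have hvM : {v} ∈ unmatched F M := by rw [hcrit]; rfl
  have hne : ∀ p ∈ M, ∀ x, (x = p.1 ∨ x = p.2) → x.Nonempty ∧ x ≠ {v} := by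
    rintro p hp x (rfl | rfl)
    · exact ⟨hF _ (hM.mem p hp).1, (hvM.2 p hp).1.symm⟩
    · exact ⟨hF _ (hM.mem p hp).2, (hvM.2 p hp).2.symm⟩
  let g : ι → Finset V × Finset V → Finset W × Finset W :=
    fun i p => (p.1.image (φ i), p.2.image (φ i))
  let M' : Set (Finset W × Finset W) := {q | ∃ i, ∃ p ∈ M, g i p = q}
  refine ⟨M', ⟨?_, ⟨?_, ?_⟩, ?_⟩, ?_⟩
  · rintro _ ⟨i, p, hp, rfl⟩
    exact ⟨⟨i, _, (hM.mem p hp).1, rfl⟩, ⟨i, _, (hM.mem p hp).2, rfl⟩⟩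
  · rintro _ ⟨i, p, hp, rfl⟩
    exact (image_covBy_image_iff (hφ.injective i)).2 (hM.matching.1 p hp)
  · rintro x _ ⟨i, p, hp, rfl⟩ _ ⟨j, q, hq, rfl⟩ hx hy
    obtain ⟨s, hs, rfl⟩ : ∃ s, (s = p.1 ∨ s = p.2) ∧ x = s.image (φ i) := by
      rcases hx with h | h
      exacts [⟨_, Or.inl rfl, h⟩, ⟨_, Or.inr rfl, h⟩]
    obtain ⟨t, ht, hst⟩ : ∃ t, (t = q.1 ∨ t = q.2) ∧ s.image (φ i) = t.image (φ j) := by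
      rcases hy with h | h
      exacts [⟨_, Or.inl rfl, h⟩, ⟨_, Or.inr rfl, h⟩]
    obtain ⟨hs1, hs2⟩ := hne p hp s hs
    obtain ⟨rfl, rfl⟩ := hφ.eq_of_image_eq hs1 hs2 hst
    rw [hM.matching.2 s p hp q hq hs ht]
  · rintro ⟨n, hn, a, b, hb, hab⟩
    have : NeZero n := ⟨by omega⟩
    choose k p hp hpg using fun i => (hab i).1
    have ha : ∀ i, a i = (p i).1.image (φ (k i)) := fun i => (congrArg Prod.fst (hpg i)).symm
    have hb' : ∀ i, b i = (p i).2.image (φ (k i)) := fun i => (congrArg Prod.snd (hpg i)).symm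
    -- Each `a (i + 1)` is matched, hence not the base vertex, so a cycle cannot change from one
    -- copy to another.
    have hstep : ∀ i, k (i + 1) = k i := fun i => by
      have h := (hab i).2.2.le
      rw [ha, hb'] at h
      obtain ⟨h1, h2⟩ := hne _ (hp (i + 1)) _ (Or.inl rfl)
      exact hφ.index_eq h1 h2 h
    refine hM.acyclic ⟨n, hn, fun i => (p i).1, fun i => (p i).2, ?_, fun i =>
      ⟨hp i, hM.matching.1 _ (hp i), ?_⟩⟩
    · have hconst : ∀ m : ℕ, k (m : ZMod n) = k 0 := by
        intro m
        induction m with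
        | zero => simp
        | succ m ih => rw [Nat.cast_succ, hstep, ih]
      have hk : ∀ i, k i = k 0 := fun i => by
        rw [← ZMod.natCast_zmod_val i]; exact hconst _
      intro i j hij
      refine hb ?_
      rw [hb' i, hb' j, hk i, hk j]
      exact congrArg _ hij
    · have h := (hab i).2.2
      rw [ha, hb', hstep] at h
      exact (image_covBy_image_iff (hφ.injective _)).1 h
  · have key : ∀ t ∈ unmatched (wedgeFaces φ F) M', ∃ i, t = {φ i v} := by
      rintro _ ⟨⟨i, s, hs, rfl⟩, ht⟩
      refine ⟨i, ?_⟩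
      have hsu : s ∈ unmatched F M := ⟨hs, fun p hp => ⟨?_, ?_⟩⟩
      · rw [hcrit] at hsu
        rw [Set.mem_singleton_iff.1 hsu, Finset.image_singleton]
      · rintro rfl
        exact (ht _ ⟨i, p, hp, rfl⟩).1 rfl
      · rintro rfl
        exact (ht _ ⟨i, p, hp, rfl⟩).2 rfl
    intro s hs t ht
    obtain ⟨i, rfl⟩ := key s hs
    obtain ⟨j, rfl⟩ := key t ht
    rw [hφ.base i j]

/-- A matching of a wedge with fewer critical simplices than there are copies has a copy with no
critical simplex except possibly the base vertex. -/
theorem MorseOn.exists_copy [Fintype ι] (hφ : IsWedgeFamily φ v)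
    (K : PreAbstractSimplicialComplex V) {M : Set (Finset W × Finset W)}
    (hM : MorseOn (wedgeFaces φ K.faces) M)
    (hfin : (unmatched (wedgeFaces φ K.faces) M).Finite)
    (hcard : (unmatched (wedgeFaces φ K.faces) M).ncard < Fintype.card ι) :
    ∃ M', MorseOn K.faces M' ∧ unmatched K.faces M' ⊆ {{v}} := by
  -- Otherwise each copy has a critical simplex other than the base vertex. Those of different
  -- copies are different, so there would be at least as many as copies.
  obtain ⟨i, hi⟩ : ∃ i, ∀ s ∈ K.faces, s ≠ {v} →
      s.image (φ i) ∉ unmatched (wedgeFaces φ K.faces) M := by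
    by_contra hcon
    push Not at hcon
    choose s hs hsv hsu using hcon
    have hinj : Function.Injective fun i =>
        (⟨(s i).image (φ i), hsu i⟩ : unmatched (wedgeFaces φ K.faces) M) := by
      intro i j hij
      exact (hφ.eq_of_image_eq (K.nonempty_of_mem (hs i)) (hsv i) (congrArg Subtype.val hij)).1
    have := hfin.to_subtype
    have h := Nat.card_le_card_of_injective _ hinj
    rw [Nat.card_eq_fintype_card, Nat.card_coe_set_eq] at h
    omega
  let f := φ i
  have hf : Function.Injective f := hφ.injective i
  have hfF : Function.Injective (Finset.image f) := Finset.image_injective hf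
  -- The base vertex may be matched into another copy and lose its partner in the restriction; hence
  -- only an inclusion in `{{v}}` is claimed.
  let M' : Set (Finset V × Finset V) :=
    {p | p.1 ∈ K.faces ∧ p.2 ∈ K.faces ∧ (p.1.image f, p.2.image f) ∈ M}
  refine ⟨M', ⟨fun p hp => ⟨hp.1, hp.2.1⟩, ⟨?_, ?_⟩, ?_⟩, ?_⟩
  · rintro p ⟨-, -, hp⟩
    exact (image_covBy_image_iff hf).1 (hM.matching.1 _ hp)
  · rintro x p ⟨-, -, hp⟩ q ⟨-, -, hq⟩ hxp hxq
    have := hM.matching.2 (x.image f) _ hp _ hq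
      (hxp.imp (fun h => by rw [h]) (fun h => by rw [h]))
      (hxq.imp (fun h => by rw [h]) (fun h => by rw [h]))
    exact Prod.ext (hfF (congrArg Prod.fst this)) (hfF (congrArg Prod.snd this))
  · rintro ⟨n, hn, a, b, hb, hab⟩
    exact hM.acyclic ⟨n, hn, fun i => (a i).image f, fun i => (b i).image f, hfF.comp hb,
      fun i => ⟨(hab i).1.2.2, (image_covBy_image_iff hf).2 (hab i).2.1,
        (image_covBy_image_iff hf).2 (hab i).2.2⟩⟩
  · rintro s ⟨hs, hsM⟩
    by_contra hsv
    -- A partner of `s` in the wedge lies in the same copy: a larger one contains a vertex of `s`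
    -- other than `v`, and a smaller one is a face of `s`.
    refine hi s hs hsv ⟨⟨i, s, hs, rfl⟩, fun p hp => ⟨fun h => ?_, fun h => ?_⟩⟩
    · obtain ⟨j, t, ht, hpt⟩ := (hM.mem p hp).2
      have hle := (hM.matching.1 p hp).le
      rw [← h, ← hpt] at hle
      obtain rfl := hφ.index_eq (K.nonempty_of_mem hs) hsv hle
      refine (hsM (s, t) ⟨hs, ht, ?_⟩).1 rfl
      show (s.image (φ i), t.image (φ i)) ∈ M
      rw [h, hpt]
      exact hp
    · have hle := (hM.matching.1 p hp).le
      rw [← h] at hle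
      obtain ⟨t, ht, hpt⟩ := Finset.subset_image_iff.1 hle
      have htne : t.Nonempty := by
        obtain ⟨j, t', ht', hpt'⟩ := (hM.mem p hp).1
        rw [← Finset.image_nonempty (f := φ i), hpt, ← hpt', Finset.image_nonempty]
        exact K.nonempty_of_mem ht'
      refine (hsM (t, s) ⟨K.mem_of_subset hs ht htne, hs, ?_⟩).2 rfl
      show (t.image (φ i), s.image (φ i)) ∈ M
      rw [h, hpt]
      exact hp

end WedgeMatchings

/-! ### Matchings of the face poset -/

section FacePosets

variable {V : Type*} {K : AbstractSimplicialComplex V}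

/-- A nonempty set below a face is a face, so nothing between two faces is lost in the face poset
and the covering relations agree. -/
theorem facePoset_covBy_iff {a b : FacePoset K} : a ⋖ b ↔ a.1 ⋖ b.1 := by
  constructor
  · rintro ⟨hlt, h⟩
    refine ⟨hlt, fun c hac hcb => ?_⟩
    exact h (c := ⟨c, K.toPreAbstractSimplicialComplex.mem_of_subset b.2 hcb.le
      ((K.nonempty_of_mem a.2).mono hac.le)⟩) hac hcb
  · rintro ⟨hlt, h⟩
    exact ⟨hlt, fun c hac hcb => h (c := c.1) hac hcb⟩

/-- The underlying pairs of finite sets. -/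
def rawPairs (M : Set (FacePoset K × FacePoset K)) : Set (Finset V × Finset V) :=
  {p | ∃ q ∈ M, (q.1.1, q.2.1) = p}

theorem IsMorseMatching.morseOn {M : Set (FacePoset K × FacePoset K)} (h : IsMorseMatching K M) :
    MorseOn K.faces (rawPairs M) := by
  obtain ⟨⟨h1, h2⟩, h3⟩ := h
  refine ⟨?_, ⟨?_, ?_⟩, ?_⟩
  · rintro _ ⟨q, -, rfl⟩
    exact ⟨q.1.2, q.2.2⟩
  · rintro _ ⟨q, hq, rfl⟩
    exact facePoset_covBy_iff.1 (h1 q hq)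
  · rintro x _ ⟨q, hq, rfl⟩ _ ⟨r, hr, rfl⟩ hxq hxr
    have hx : x ∈ K.faces := by
      rcases hxq with rfl | rfl
      exacts [q.1.2, q.2.2]
    rw [h2 ⟨x, hx⟩ q hq r hr (hxq.imp Subtype.ext Subtype.ext) (hxr.imp Subtype.ext Subtype.ext)]
  · rintro ⟨n, hn, a, b, hb, hab⟩
    choose q hq hqe using fun i => (hab i).1
    have ha : ∀ i, a i = (q i).1.1 := fun i => (congrArg Prod.fst (hqe i)).symm
    have hb' : ∀ i, b i = (q i).2.1 := fun i => (congrArg Prod.snd (hqe i)).symm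
    refine h3 ⟨n, hn, fun i => (q i).1, fun i => (q i).2, ?_, fun i => ⟨hq i, h1 _ (hq i), ?_⟩⟩
    · intro i j hij
      refine hb ?_
      rw [hb' i, hb' j]
      exact congrArg Subtype.val hij
    · have := (hab i).2.2
      rw [ha, hb'] at this
      exact facePoset_covBy_iff.2 this

theorem MorseOn.isMorseMatching {M : Set (Finset V × Finset V)} (h : MorseOn K.faces M) :
    IsMorseMatching K {q | (q.1.1, q.2.1) ∈ M} := by
  refine ⟨⟨fun q hq => facePoset_covBy_iff.2 (h.matching.1 _ hq), ?_⟩, ?_⟩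
  · intro x q hq r hr hxq hxr
    have := h.matching.2 x.1 _ hq _ hr (hxq.imp (congrArg _) (congrArg _))
      (hxr.imp (congrArg _) (congrArg _))
    exact Prod.ext (Subtype.ext (congrArg Prod.fst this)) (Subtype.ext (congrArg Prod.snd this))
  · rintro ⟨n, hn, a, b, hb, hab⟩
    exact h.acyclic ⟨n, hn, fun i => (a i).1, fun i => (b i).1, Subtype.val_injective.comp hb,
      fun i => ⟨(hab i).1, facePoset_covBy_iff.1 (hab i).2.1, facePoset_covBy_iff.1 (hab i).2.2⟩⟩

theorem MorseOn.rawPairs_eq {M : Set (Finset V × Finset V)} (h : MorseOn K.faces M) :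
    rawPairs (K := K) {q | (q.1.1, q.2.1) ∈ M} = M := by
  ext p
  constructor
  · rintro ⟨q, hq, rfl⟩
    exact hq
  · intro hp
    exact ⟨(⟨p.1, (h.mem p hp).1⟩, ⟨p.2, (h.mem p hp).2⟩), hp, rfl⟩

theorem numCritical_eq (M : Set (FacePoset K × FacePoset K)) :
    numCritical K M = (unmatched K.faces (rawPairs M)).ncard := by
  have : unmatched K.faces (rawPairs M) = Subtype.val '' criticalSimplices K M := by
    ext s
    constructor
    · rintro ⟨hs, h⟩
      refine ⟨⟨s, hs⟩, fun p hp => ?_, rfl⟩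
      have := h _ ⟨p, hp, rfl⟩
      exact ⟨fun e => this.1 (congrArg Subtype.val e), fun e => this.2 (congrArg Subtype.val e)⟩
    · rintro ⟨s, hs, rfl⟩
      refine ⟨s.2, ?_⟩
      rintro _ ⟨q, hq, rfl⟩
      have := hs q hq
      exact ⟨fun e => this.1 (Subtype.ext e), fun e => this.2 (Subtype.ext e)⟩
  rw [this, Set.ncard_image_of_injective _ Subtype.val_injective]
  rfl

end FacePosets

/-! ### The amplified complex -/

section Amplified

theorem isWedgeFamily_wedgeInclusion {V W : Type*} [DecidableEq V] (N : ℕ) (v : V)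
    (e : WedgeVertex N v ≃ W) : IsWedgeFamily (fun i w => e (wedgeInclusion N v i w)) v := by
  refine ⟨fun i x y h => ?_, fun i j => ?_, fun i j x y h hx => ?_⟩
  · have := e.injective h
    unfold wedgeInclusion at this
    split_ifs at this with hx hy <;> simp_all
  · simp [wedgeInclusion]
  · have := e.injective h
    unfold wedgeInclusion at this
    split_ifs at this with hy <;> simp_all

theorem mem_wedge_map_faces {V W : Type*} [DecidableEq V] [DecidableEq W]
    (K : AbstractSimplicialComplex V) (N : ℕ) (v : V) (f : WedgeVertex N v → W) :
    ((wedge K N v).map f).faces =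
      wedgeFaces (fun i w => f (wedgeInclusion N v i w)) K.faces := by
  have hsup : ∀ t, t ∈ (wedge K N v).faces ↔
      ∃ i, ∃ s ∈ K.faces, s.image (wedgeInclusion N v i) = t := by
    intro t
    have : (wedge K N v).faces = ⋃ L ∈ Set.range (fun i : Fin N =>
      K.toPreAbstractSimplicialComplex.map (wedgeInclusion N v i)), L.faces := rfl
    rw [this]
    simp only [Set.mem_range, Set.iUnion_exists, Set.iUnion_iUnion_eq', Set.mem_iUnion]
    rfl
  ext t
  constructor
  · rintro ⟨s, hs, rfl⟩
    obtain ⟨i, r, hr, rfl⟩ := (hsup s).1 hs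
    exact ⟨i, r, hr, by simp only [Finset.image_image]; rfl⟩
  · rintro ⟨i, r, hr, rfl⟩
    exact ⟨_, (hsup _).2 ⟨i, r, hr, rfl⟩, by simp only [Finset.image_image]; rfl⟩

theorem ComplexInput.size_eq_ncard (K : ComplexInput) : K.size = K.complex.faces.ncard := by
  have : K.complex.faces = (K.simplices.toFinset : Set (Finset (Fin K.numVertices))) := by
    ext s
    simp [K.mem_simplices s]
  rw [this, Set.ncard_coe_finset, List.toFinset_card_of_nodup K.nodup_simplices]
  rfl

theorem ComplexInput.finite_faces (K : ComplexInput) : K.complex.faces.Finite :=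
  Set.toFinite _

theorem ncard_wedgeFaces_le {V W : Type*} [DecidableEq W] {n : ℕ} (φ : Fin n → V → W)
    {F : Set (Finset V)} (hF : F.Finite) : (wedgeFaces φ F).ncard ≤ n * F.ncard := by
  classical
  have : wedgeFaces φ F = (fun q : Fin n × Finset V => q.2.image (φ q.1)) '' (Set.univ ×ˢ F) := by
    ext t
    constructor
    · rintro ⟨i, s, hs, rfl⟩
      exact ⟨(i, s), ⟨trivial, hs⟩, rfl⟩
    · rintro ⟨⟨i, s⟩, ⟨-, hs⟩, rfl⟩
      exact ⟨i, s, hs, rfl⟩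
  rw [this]
  refine (Set.ncard_image_le (Set.finite_univ.prod hF)).trans ?_
  rw [Set.ncard_prod, Set.ncard_univ, Nat.card_eq_fintype_card, Fintype.card_fin]

theorem le_ncard_wedgeFaces {ι V W : Type*} [DecidableEq V] [DecidableEq W] {φ : ι → V → W} {v : V}
    (hφ : IsWedgeFamily φ v) (i : ι) {F : Set (Finset V)} (h : (wedgeFaces φ F).Finite) :
    F.ncard ≤ (wedgeFaces φ F).ncard :=
  Set.ncard_le_ncard_of_injOn (fun s => s.image (φ i)) (fun s hs => ⟨i, s, hs, rfl⟩)
    ((Finset.image_injective (hφ.injective i)).injOn) h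

/-- The growth estimate behind the amplification. -/
theorem approximation_lt {ε p : ℝ} (hε0 : 0 < ε) (hε1 : ε ≤ 1) (hp : 0 < p) {c n s : ℕ}
    (hc : c = ⌊1 / ε + 1⌋₊) (hn : p ^ (1 / (c * ε - 1)) < n) (hs : s ≤ n ^ (c - 1) * n) :
    p * (s : ℝ) ^ (1 - ε) < (n : ℝ) ^ (c - 1) := by
  -- The floor of `1 / ε + 1` exceeds `1 / ε`; this gives `c * ε > 1`.
  have hc1 : 1 / ε < c := by
    have := Nat.lt_floor_add_one (1 / ε + 1)
    rw [← hc] at this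
    linarith
  have hcε : 0 < c * ε - 1 := by
    rw [div_lt_iff₀ hε0] at hc1
    linarith
  have hc0 : 1 ≤ c := by
    by_contra h
    have : c = 0 := by omega
    rw [this] at hcε
    simp at hcε
    linarith
  have hn0 : (0 : ℝ) < n := (Real.rpow_pos_of_pos hp _).trans hn
  have hpn : p < (n : ℝ) ^ (c * ε - 1) := by
    have h := Real.rpow_lt_rpow (Real.rpow_nonneg hp.le _) hn hcε
    rwa [← Real.rpow_mul hp.le, one_div, inv_mul_cancel₀ hcε.ne', Real.rpow_one] at h
  have hs' : (s : ℝ) ≤ (n : ℝ) ^ (c : ℝ) := by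
    rw [Real.rpow_natCast]
    have : n ^ (c - 1) * n = n ^ c := by rw [← pow_succ, Nat.sub_add_cancel hc0]
    rw [this] at hs
    exact_mod_cast hs
  calc p * (s : ℝ) ^ (1 - ε) ≤ p * ((n : ℝ) ^ (c : ℝ)) ^ (1 - ε) := by
        gcongr
    _ < (n : ℝ) ^ (c * ε - 1) * ((n : ℝ) ^ (c : ℝ)) ^ (1 - ε) := by
        gcongr
    -- The exponents add up: `(c * ε - 1) + c * (1 - ε) = c - 1`.
    _ = (n : ℝ) ^ ((c : ℝ) - 1) := by
        rw [← Real.rpow_mul hn0.le, ← Real.rpow_add hn0]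
        congr 1
        ring
    _ = (n : ℝ) ^ (c - 1) := by
        rw [← Real.rpow_natCast, Nat.cast_sub hc0, Nat.cast_one]

/-- Collapsibility is read off from an approximate solution for the amplified complex. -/
theorem isCollapsible_iff_numCritical_lt {ε : ℝ} (hε0 : 0 < ε) (hε1 : ε ≤ 1) {A : MatchingMap}
    {α : ℕ → ℝ} (hA : IsMinMMApproximation α A) {c : ℕ} {p N : ℝ} (hc : c = ⌊1 / ε + 1⌋₊)
    (hp : 0 < p) (hαp : ∀ n : ℕ, N ≤ n → α n ≤ p * (n : ℝ) ^ (1 - ε))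
    (K : ComplexInput) (v : Fin K.numVertices) (Q : ComplexInput)
    (hK : max (p ^ (1 / (c * ε - 1))) N < K.size) (hQ : IsAmplifiedComplex K v c Q) :
    IsCollapsible K.complex.toPreAbstractSimplicialComplex ↔
      numCritical Q.complex (A.output Q) < K.size ^ (c - 1) := by
  obtain ⟨e, he⟩ := hQ
  let φ : Fin (K.size ^ (c - 1)) → Fin K.numVertices → Fin Q.numVertices :=
    fun i w => e (wedgeInclusion _ v i w)
  have hφ : IsWedgeFamily φ v := isWedgeFamily_wedgeInclusion _ v e
  have hfaces : Q.complex.faces = wedgeFaces φ K.complex.faces := by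
    rw [he]
    exact mem_wedge_map_faces _ _ _ _
  have hv : {v} ∈ K.complex.faces := K.complex.singleton_mem v
  have hpos : 0 < K.size := by
    rw [K.size_eq_ncard, Set.ncard_pos K.finite_faces]
    exact ⟨_, hv⟩
  constructor
  · rintro ⟨L, w, hL, hcol⟩
    obtain ⟨M, hM, hcrit⟩ := hcol.exists_morseOn hL hv
    obtain ⟨M', hM', hsub⟩ := hM.wedge hφ (fun s hs => K.complex.nonempty_of_mem hs) hcrit
    rw [← hfaces] at hM' hsub
    have hopt := (hA.2 Q).2.2 _ hM'.isMorseMatching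
    rw [numCritical_eq (K := Q.complex) {q | _}, hM'.rawPairs_eq] at hopt
    have h1 : (unmatched Q.complex.faces M').ncard ≤ 1 :=
      Set.ncard_le_one_iff_subsingleton.2 hsub
    have hQs : Q.size ≤ K.size ^ (c - 1) * K.size := by
      rw [Q.size_eq_ncard, hfaces]
      exact (ncard_wedgeFaces_le φ K.finite_faces).trans_eq (by rw [← K.size_eq_ncard])
    -- The bound on `α` is applied at the size of the wedge, which is past `N` because the wedge
    -- contains a copy of `K`.
    have hKQ : K.size ≤ Q.size := by
      rw [Q.size_eq_ncard]
      nth_rewrite 1 [K.size_eq_ncard]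
      have hfin := Q.finite_faces
      rw [hfaces] at hfin ⊢
      exact le_ncard_wedgeFaces hφ ⟨0, by positivity⟩ hfin
    have hαQ := hαp Q.size ((le_max_right _ _).trans (hK.le.trans (by exact_mod_cast hKQ)))
    have hlt := approximation_lt hε0 hε1 hp hc ((le_max_left _ _).trans_lt hK) hQs
    have hβ : 0 ≤ p * (Q.size : ℝ) ^ (1 - ε) := by positivity
    have : (numCritical Q.complex (A.output Q) : ℝ) < (K.size : ℝ) ^ (c - 1) := by
      refine (hopt.trans ?_).trans_lt hlt
      have h1' : ((unmatched Q.complex.faces M').ncard : ℝ) ≤ 1 := by exact_mod_cast h1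
      calc _ ≤ p * (Q.size : ℝ) ^ (1 - ε) * (unmatched Q.complex.faces M').ncard := by gcongr
        _ ≤ p * (Q.size : ℝ) ^ (1 - ε) * 1 := by gcongr
        _ = _ := mul_one _
    exact_mod_cast this
  · intro hlt
    have hM := (hA.2 Q).2.1.morseOn
    rw [numCritical_eq] at hlt
    rw [hfaces] at hM hlt
    have hfin : (unmatched (wedgeFaces φ K.complex.faces) (rawPairs (A.output Q))).Finite :=
      Set.toFinite _
    obtain ⟨M', hM', hcrit⟩ := hM.exists_copy hφ K.complex.toPreAbstractSimplicialComplex hfin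
      (by rwa [Fintype.card_fin])
    exact hM'.isCollapsible K.finite_faces ⟨_, hv⟩ hcrit

end Amplified

/-! ### Structured programs for stack machines -/

section StackPrograms

open Turing Turing.TM2 StateTransition

variable {K : Type} [DecidableEq K] {Γ : K → Type} {σ : Type}

/-- The internal state of the machines built here: a state of an embedded machine and a register
for the symbol that was read last. -/
abbrev RegState (σ : Type) : Type := σ × Option (Option Bool)

/-- A piece of a program with one entry and one exit. It has its own labels; the statement that
is executed after it is a parameter. -/
structure Fragment (Γ : K → Type) (σ : Type) where
  Label : Type
  finLabel : Fintype Label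
  entry : ∀ {Λ : Type}, (Label → Λ) → Stmt Γ Λ (RegState σ) → Stmt Γ Λ (RegState σ)
  code : ∀ {Λ : Type}, (Label → Λ) → Stmt Γ Λ (RegState σ) → Label → Stmt Γ Λ (RegState σ)

namespace Fragment

/-- The fragment leads from the stacks `S` to the stacks `S'` in at most `t` steps, starting and
ending in the state `s` with an empty register. -/
def Runs (F : Fragment Γ σ) (s : σ) (S : ∀ k, List (Γ k)) (t : ℕ) (S' : ∀ k, List (Γ k)) : Prop :=
  ∀ (Λ : Type) (M : Λ → Stmt Γ Λ (RegState σ)) (ι : F.Label → Λ) (q : Stmt Γ Λ (RegState σ)),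
    (∀ l, M (ι l) = F.code ι q l) → ∃ t' ≤ t,
      (flip bind (step M))^[t'] (some (stepAux (F.entry ι q) (s, none) S)) =
        some (stepAux q (s, none) S')

theorem Runs.mono {F : Fragment Γ σ} {s : σ} {S S' : ∀ k, List (Γ k)} {t u : ℕ}
    (h : F.Runs s S t S') (htu : t ≤ u) : F.Runs s S u S' := fun Λ M ι q hM => by
  obtain ⟨t', ht', h'⟩ := h Λ M ι q hM
  exact ⟨t', ht'.trans htu, h'⟩

theorem Runs.congr {F : Fragment Γ σ} {s : σ} {S S' T T' : ∀ k, List (Γ k)} {t : ℕ}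
    (h : F.Runs s S t S') (e : S = T) (e' : S' = T') : F.Runs s T t T' := e ▸ e' ▸ h

/-- The fragment that does nothing. -/
def skip : Fragment Γ σ where
  Label := Empty
  finLabel := inferInstance
  entry _ q := q
  code _ _ l := l.elim

/-- No step is charged for straight-line code: a statement is executed up to its next `goto` or
`halt` within one machine step. Only loops and calls cost time. -/
theorem runs_skip (s : σ) (S : ∀ k, List (Γ k)) : (skip : Fragment Γ σ).Runs s S 0 S :=
  fun _ _ _ _ _ => ⟨0, le_rfl, rfl⟩

/-- Push a symbol. -/
def push (k : K) (a : Γ k) : Fragment Γ σ where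
  Label := Empty
  finLabel := inferInstance
  entry _ q := .push k (fun _ => a) q
  code _ _ l := l.elim

theorem runs_push (k : K) (a : Γ k) (s : σ) (S : ∀ k, List (Γ k)) :
    (push k a : Fragment Γ σ).Runs s S 0 (Function.update S k (a :: S k)) :=
  fun _ _ _ _ _ => ⟨0, le_rfl, rfl⟩

/-- Execute one fragment after the other. -/
def seq (F G : Fragment Γ σ) : Fragment Γ σ where
  Label := F.Label ⊕ G.Label
  finLabel := @instFintypeSum _ _ F.finLabel G.finLabel
  entry ι q := F.entry (ι ∘ Sum.inl) (G.entry (ι ∘ Sum.inr) q)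
  code ι q
    | .inl l => F.code (ι ∘ Sum.inl) (G.entry (ι ∘ Sum.inr) q) l
    | .inr l => G.code (ι ∘ Sum.inr) q l

/-- `Runs` quantifies over the ambient machine, the placement of the labels and the continuation. So
`G` together with what follows it can serve as the continuation of `F`. -/
theorem Runs.seq {F G : Fragment Γ σ} {s : σ} {S S' S'' : ∀ k, List (Γ k)} {t u : ℕ}
    (hF : F.Runs s S t S') (hG : G.Runs s S' u S'') : (F.seq G).Runs s S (t + u) S'' := by
  intro Λ M ι q hM
  obtain ⟨t', ht', h⟩ := hF Λ M (ι ∘ Sum.inl) (G.entry (ι ∘ Sum.inr) q) fun l => hM (.inl l)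
  obtain ⟨u', hu', h'⟩ := hG Λ M (ι ∘ Sum.inr) q fun l => hM (.inr l)
  refine ⟨u' + t', by omega, ?_⟩
  rw [Function.iterate_add_apply]
  exact (congrArg _ h).trans h'

/-- Pop a symbol and branch on it; `d` reads the symbol as an element of `Option Bool`. -/
def popStmt {Λ : Type} (k : K) (d : Γ k → Option Bool) (q₀ : Stmt Γ Λ (RegState σ))
    (q : Option Bool → Stmt Γ Λ (RegState σ)) : Stmt Γ Λ (RegState σ) :=
  .pop k (fun s x => (s.1, x.map d)) <|
    .branch (fun s => s.2 == none) (.load (fun s => (s.1, none)) q₀) <|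
    .branch (fun s => s.2 == some none) (.load (fun s => (s.1, none)) (q none)) <|
    .branch (fun s => s.2 == some (some true)) (.load (fun s => (s.1, none)) (q (some true)))
      (.load (fun s => (s.1, none)) (q (some false)))

theorem stepAux_popStmt_nil {Λ : Type} {k : K} {d : Γ k → Option Bool}
    {q₀ : Stmt Γ Λ (RegState σ)} {q : Option Bool → Stmt Γ Λ (RegState σ)} {s : σ}
    {S : ∀ k, List (Γ k)} (h : S k = []) :
    stepAux (popStmt k d q₀ q) (s, none) S = stepAux q₀ (s, none) S := by
  have : Function.update S k [] = S := by rw [← h, Function.update_eq_self]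
  simp [popStmt, h, this]

/-- Branching can depend only on the internal state, so the popped symbol passes through the
register, which every branch empties again. -/
theorem stepAux_popStmt_cons {Λ : Type} {k : K} {d : Γ k → Option Bool}
    {q₀ : Stmt Γ Λ (RegState σ)} {q : Option Bool → Stmt Γ Λ (RegState σ)} {s : σ}
    {S : ∀ k, List (Γ k)} {a : Γ k} {l : List (Γ k)} (h : S k = a :: l) :
    stepAux (popStmt k d q₀ q) (s, none) S =
      stepAux (q (d a)) (s, none) (Function.update S k l) := by
  rcases hd : d a with _ | b
  · simp [popStmt, h, hd]
  · cases b <;> simp [popStmt, h, hd]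

/-- Pop a symbol and continue with a fragment that depends on it. -/
def popCase (k : K) (d : Γ k → Option Bool) (F₀ : Fragment Γ σ)
    (F : Option Bool → Fragment Γ σ) : Fragment Γ σ where
  Label := F₀.Label ⊕ Σ a, (F a).Label
  finLabel := by
    have := F₀.finLabel
    have := fun a => (F a).finLabel
    exact inferInstance
  entry ι q := popStmt k d (F₀.entry (ι ∘ Sum.inl) q)
    fun a => (F a).entry (fun l => ι (.inr ⟨a, l⟩)) q
  code ι q
    | .inl l => F₀.code (ι ∘ Sum.inl) q l
    | .inr ⟨a, l⟩ => (F a).code (fun l => ι (.inr ⟨a, l⟩)) q l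

omit [DecidableEq K] in
theorem entry_popCase {Λ : Type} {k : K} {d : Γ k → Option Bool} {F₀ : Fragment Γ σ}
    {F : Option Bool → Fragment Γ σ} (ι : (popCase k d F₀ F).Label → Λ)
    (q : Stmt Γ Λ (RegState σ)) :
    (popCase k d F₀ F).entry ι q = popStmt k d (F₀.entry (fun l => ι (.inl l)) q)
      fun a => (F a).entry (fun l => ι (.inr ⟨a, l⟩)) q := by
  unfold popCase
  rfl

theorem runs_popCase_nil {k : K} {d : Γ k → Option Bool} {F₀ : Fragment Γ σ}
    {F : Option Bool → Fragment Γ σ} {s : σ} {S S' : ∀ k, List (Γ k)} {t : ℕ} (hk : S k = [])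
    (h : F₀.Runs s S t S') : (popCase k d F₀ F).Runs s S t S' := by
  intro Λ M ι q hM
  obtain ⟨t', ht', h⟩ := h Λ M (ι ∘ Sum.inl) q fun l => hM (.inl l)
  refine ⟨t', ht', ?_⟩
  rw [entry_popCase, stepAux_popStmt_nil hk]
  exact h

theorem runs_popCase_cons {k : K} {d : Γ k → Option Bool} {F₀ : Fragment Γ σ}
    {F : Option Bool → Fragment Γ σ} {s : σ} {S S' : ∀ k, List (Γ k)} {t : ℕ} {a : Γ k}
    {l : List (Γ k)} (hk : S k = a :: l) (h : (F (d a)).Runs s (Function.update S k l) t S') :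
    (popCase k d F₀ F).Runs s S t S' := by
  intro Λ M ι q hM
  obtain ⟨t', ht', h⟩ := h Λ M (fun l => ι (.inr ⟨d a, l⟩)) q fun l => hM (.inr ⟨d a, l⟩)
  refine ⟨t', ht', ?_⟩
  rw [entry_popCase, stepAux_popStmt_cons hk]
  exact h

/-- Pop symbols and execute `F` for each of them, until the stack is empty or a symbol with
`isLast` is read. -/
def loop (k : K) (d : Γ k → Option Bool) (isLast : Option Bool → Bool)
    (F : Option Bool → Fragment Γ σ) : Fragment Γ σ where
  Label := Unit ⊕ Σ a, (F a).Label
  finLabel := by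
    have := fun a => (F a).finLabel
    exact inferInstance
  entry ι _ := .goto fun _ => ι (.inl ())
  code ι q
    | .inl _ => popStmt k d q fun a =>
        if isLast a then q
        else (F a).entry (fun l => ι (.inr ⟨a, l⟩)) (.goto fun _ => ι (.inl ()))
    | .inr ⟨a, l⟩ => (F a).code (fun l => ι (.inr ⟨a, l⟩)) (.goto fun _ => ι (.inl ())) l

omit [DecidableEq K] in
theorem code_loop {Λ : Type} {k : K} {d : Γ k → Option Bool} {isLast : Option Bool → Bool}
    {F : Option Bool → Fragment Γ σ} (ι : (loop k d isLast F).Label → Λ)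
    (q : Stmt Γ Λ (RegState σ)) :
    (loop k d isLast F).code ι q (.inl ()) = popStmt k d q fun a =>
      if isLast a then q
      else (F a).entry (fun l => ι (.inr ⟨a, l⟩)) (.goto fun _ => ι (.inl ())) := by
  unfold loop
  rfl

theorem iterate_bind_succ {α : Type} (f : α → Option α) (n : ℕ) {a b : α} (h : f a = some b) :
    (flip bind f)^[n + 1] (some a) = (flip bind f)^[n] (some b) := by
  rw [Function.iterate_succ_apply]
  congr 1

theorem runs_loop_nil {k : K} {d : Γ k → Option Bool} {isLast : Option Bool → Bool}
    {F : Option Bool → Fragment Γ σ} {s : σ} {S : ∀ k, List (Γ k)} (hk : S k = []) :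
    (loop k d isLast F).Runs s S 1 S := by
  intro Λ M ι q hM
  refine ⟨1, le_rfl, ?_⟩
  refine iterate_bind_succ _ 0 (b := stepAux q (s, none) S) ?_
  show some (stepAux (M (ι (.inl ()))) (s, none) S) = _
  rw [hM (.inl ()), code_loop, stepAux_popStmt_nil hk]

theorem runs_loop_last {k : K} {d : Γ k → Option Bool} {isLast : Option Bool → Bool}
    {F : Option Bool → Fragment Γ σ} {s : σ} {S : ∀ k, List (Γ k)} {a : Γ k} {l : List (Γ k)}
    (hk : S k = a :: l) (ha : isLast (d a) = true) :
    (loop k d isLast F).Runs s S 1 (Function.update S k l) := by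
  intro Λ M ι q hM
  refine ⟨1, le_rfl, ?_⟩
  refine iterate_bind_succ _ 0 (b := stepAux q (s, none) (Function.update S k l)) ?_
  show some (stepAux (M (ι (.inl ()))) (s, none) S) = _
  rw [hM (.inl ()), code_loop, stepAux_popStmt_cons hk, if_pos ha]

theorem runs_loop_cons {k : K} {d : Γ k → Option Bool} {isLast : Option Bool → Bool}
    {F : Option Bool → Fragment Γ σ} {s : σ} {S S' S'' : ∀ k, List (Γ k)} {a : Γ k}
    {l : List (Γ k)} {t u : ℕ} (hk : S k = a :: l) (ha : isLast (d a) = false)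
    (hF : (F (d a)).Runs s (Function.update S k l) t S')
    (hloop : (loop k d isLast F).Runs s S' u S'') :
    (loop k d isLast F).Runs s S (1 + t + u) S'' := by
  intro Λ M ι q hM
  obtain ⟨t', ht', h⟩ := hF Λ M (fun l => ι (.inr ⟨d a, l⟩)) (.goto fun _ => ι (.inl ()))
    fun l => hM (.inr ⟨d a, l⟩)
  obtain ⟨u', hu', h'⟩ := hloop Λ M ι q hM
  refine ⟨u' + t' + 1, by omega, ?_⟩
  have hstep : step M (stepAux ((loop k d isLast F).entry ι q) (s, none) S) =
      some (stepAux ((F (d a)).entry (fun l => ι (.inr ⟨d a, l⟩)) (.goto fun _ => ι (.inl ())))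
        (s, none) (Function.update S k l)) := by
    show some (stepAux (M (ι (.inl ()))) (s, none) S) = _
    rw [hM (.inl ()), code_loop, stepAux_popStmt_cons hk, if_neg (by simp [ha])]
  rw [iterate_bind_succ _ _ hstep, Function.iterate_add_apply]
  exact (congrArg _ h).trans h'

end Fragment

/-! ### Embedding a machine -/

section Embedding

variable {K₁ K₂ : Type} [DecidableEq K₁] [DecidableEq K₂] {Γ₁ : K₁ → Type} {Γ₂ : K₂ → Type}
  {Λ₁ Λ : Type}

/-- Two families of stacks side by side. -/
def sumStacks (S : ∀ k, List (Γ₁ k)) (T : ∀ k, List (Γ₂ k)) :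
    ∀ k : K₁ ⊕ K₂, List (Sum.elim Γ₁ Γ₂ k)
  | .inl k => S k
  | .inr k => T k

theorem update_sumStacks_inl (S : ∀ k, List (Γ₁ k)) (T : ∀ k, List (Γ₂ k)) (k : K₁)
    (l : List (Γ₁ k)) : Function.update (sumStacks S T) (.inl k) l =
      sumStacks (Function.update S k l) T := by
  funext x
  rcases x with x | x
  · by_cases h : x = k
    · subst h
      exact (Function.update_self _ _ _).trans (Function.update_self x l S).symm
    · exact (Function.update_of_ne (by simpa using h) _ _).trans
        (by simp [sumStacks, h])
  · exact Function.update_of_ne (by simp) _ _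

theorem update_sumStacks_inr (S : ∀ k, List (Γ₁ k)) (T : ∀ k, List (Γ₂ k)) (k : K₂)
    (l : List (Γ₂ k)) : Function.update (sumStacks S T) (.inr k) l =
      sumStacks S (Function.update T k l) := by
  funext x
  rcases x with x | x
  · exact Function.update_of_ne (by simp) _ _
  · by_cases h : x = k
    · subst h
      exact (Function.update_self _ _ _).trans (Function.update_self x l T).symm
    · exact (Function.update_of_ne (by simpa using h) _ _).trans
        (by simp [sumStacks, h])

/-- A statement of a machine as a statement of a larger machine, with `q₀` in place of halting. -/
def embedStmt (ι : Λ₁ → Λ) (q₀ : Stmt (Sum.elim Γ₁ Γ₂) Λ (RegState σ)) :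
    Stmt Γ₁ Λ₁ σ → Stmt (Sum.elim Γ₁ Γ₂) Λ (RegState σ)
  | .push k f q => .push (.inl k) (fun s => f s.1) (embedStmt ι q₀ q)
  | .peek k f q => .peek (.inl k) (fun s x => (f s.1 x, s.2)) (embedStmt ι q₀ q)
  | .pop k f q => .pop (.inl k) (fun s x => (f s.1 x, s.2)) (embedStmt ι q₀ q)
  | .load f q => .load (fun s => (f s.1, s.2)) (embedStmt ι q₀ q)
  | .branch f q q' => .branch (fun s => f s.1) (embedStmt ι q₀ q) (embedStmt ι q₀ q')
  | .goto f => .goto fun s => ι (f s.1)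
  | .halt => q₀

/-- A configuration of a machine as a configuration of a larger machine. -/
def embedCfg (ι : Λ₁ → Λ) (q₀ : Stmt (Sum.elim Γ₁ Γ₂) Λ (RegState σ)) (T : ∀ k, List (Γ₂ k)) :
    Cfg Γ₁ Λ₁ σ → Cfg (Sum.elim Γ₁ Γ₂) Λ (RegState σ)
  | ⟨some l, s, S⟩ => ⟨some (ι l), (s, none), sumStacks S T⟩
  | ⟨none, s, S⟩ => stepAux q₀ (s, none) (sumStacks S T)

/-- A halted configuration corresponds to the result of `q₀`: the step in which the embedded machine
halts also executes the continuation, and no step is lost. -/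
theorem stepAux_embedStmt (ι : Λ₁ → Λ) (q₀ : Stmt (Sum.elim Γ₁ Γ₂) Λ (RegState σ))
    (T : ∀ k, List (Γ₂ k)) (q : Stmt Γ₁ Λ₁ σ) (s : σ) (S : ∀ k, List (Γ₁ k)) :
    stepAux (embedStmt ι q₀ q) (s, none) (sumStacks S T) =
      embedCfg ι q₀ T (stepAux q s S) := by
  induction q generalizing s S with
  | push k f q ih =>
    refine Eq.trans ?_ (ih _ _)
    rw [← update_sumStacks_inl]
    rfl
  | peek k f q ih => exact ih _ _
  | pop k f q ih =>
    refine Eq.trans ?_ (ih _ _)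
    rw [← update_sumStacks_inl]
    rfl
  | load f q ih => exact ih _ _
  | branch f q q' ih ih' =>
    simp only [embedStmt, stepAux]
    cases f s
    · exact ih' _ _
    · exact ih _ _
  | goto f => rfl
  | halt => rfl

/-- The two runs agree step by step. The halting step is the last one counted, since a halted
configuration has no successor. -/
theorem iterate_embedCfg {m : Λ₁ → Stmt Γ₁ Λ₁ σ} {M : Λ → Stmt (Sum.elim Γ₁ Γ₂) Λ (RegState σ)}
    {ι : Λ₁ → Λ} {q : Stmt (Sum.elim Γ₁ Γ₂) Λ (RegState σ)}
    (hM : ∀ l, M (ι l) = embedStmt ι q (m l)) (T : ∀ k, List (Γ₂ k)) {s' : σ}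
    {S' : ∀ k, List (Γ₁ k)} (t : ℕ) (l : Λ₁) (s : σ) (S : ∀ k, List (Γ₁ k))
    (h : (flip bind (step m))^[t] (some ⟨some l, s, S⟩) = some ⟨none, s', S'⟩) :
    (flip bind (step M))^[t] (some (embedCfg ι q T ⟨some l, s, S⟩)) =
      some (embedCfg ι q T ⟨none, s', S'⟩) := by
  have hnone : ∀ t : ℕ, (flip bind (step m))^[t] none = none := fun t => by
    induction t with
    | zero => rfl
    | succ t ih => rw [Function.iterate_succ_apply]; exact ih
  induction t generalizing l s S with
  | zero => simp at h
  | succ t ih =>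
    rw [Fragment.iterate_bind_succ (step m) t (b := stepAux (m l) s S) rfl] at h
    have hstep : step M (embedCfg ι q T ⟨some l, s, S⟩) =
        some (embedCfg ι q T (stepAux (m l) s S)) := by
      rw [← stepAux_embedStmt, ← hM l]
      rfl
    rw [Fragment.iterate_bind_succ _ _ hstep]
    rcases hc : stepAux (m l) s S with ⟨_ | l', s₂, S₂⟩
    · rw [hc] at h
      cases t with
      | zero =>
        simp only [Function.iterate_zero, id_eq, Option.some.injEq] at h ⊢
        rw [h]
      | succ t =>
        rw [Function.iterate_succ_apply] at h
        have : (flip bind (step m)) (some (⟨none, s₂, S₂⟩ : Cfg Γ₁ Λ₁ σ)) = none := rfl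
        rw [this, hnone] at h
        cases h
    · rw [hc] at h
      exact ih _ _ _ h

/-- Run a machine on its own stacks. -/
def Fragment.call [Fintype Λ₁] (m : Λ₁ → Stmt Γ₁ Λ₁ σ) (l₀ : Λ₁) :
    Fragment (Sum.elim Γ₁ Γ₂) σ where
  Label := Λ₁
  finLabel := inferInstance
  entry ι _ := .goto fun _ => ι l₀
  code ι q l := embedStmt ι q (m l)

/-- The return to the state `s` fits the convention that a machine halts in its initial state, with
all stacks empty except the output. -/
theorem Fragment.runs_call [Fintype Λ₁] {m : Λ₁ → Stmt Γ₁ Λ₁ σ} {l₀ : Λ₁} {s : σ}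
    {S S' : ∀ k, List (Γ₁ k)} {t : ℕ} (T : ∀ k, List (Γ₂ k))
    (h : (flip bind (step m))^[t] (some ⟨some l₀, s, S⟩) = some ⟨none, s, S'⟩) :
    (Fragment.call m l₀).Runs s (sumStacks S T) t (sumStacks S' T) :=
  fun _ _ _ _ hM => ⟨t, le_rfl, iterate_embedCfg hM T t l₀ s S h⟩

end Embedding

end StackPrograms

/-! ### Programs with a working memory -/

section WorkingMemory

open Turing Turing.TM2 StateTransition

/-- The alphabets of the working memory: the stack `none` receives the answer, a Boolean value. -/
def workAlphabet (Own : Type) : Option Own → Type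
  | none => Bool
  | some _ => Option Bool

/-- The contents of the working stacks, and of the answer stack. -/
abbrev Memory (Own : Type) : Type := (Own → List (Option Bool)) × List Bool

variable (tm : FinTM2) {Own : Type}

/-- A program with working stacks `Own`, which may call the machine `tm`. -/
abbrev Program (Own : Type) : Type 1 :=
  Fragment (K := tm.K ⊕ Option Own) (Sum.elim tm.Γ (workAlphabet Own)) tm.σ

/-- The stacks of the working memory. -/
def Memory.stacks (p : Memory Own) : ∀ k : Option Own, List (workAlphabet Own k)
  | none => p.2
  | some o => p.1 o

theorem sumStacks_nil : sumStacks (fun _ => [] : ∀ k, List (tm.Γ k))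
    (Memory.stacks (Own := Own) (fun _ => [], [])) = fun _ => [] := by
  funext x
  rcases x with x | x | x <;> rfl

variable [DecidableEq Own]

theorem Memory.update_some (m : Own → List (Option Bool)) (b : List Bool) (o : Own)
    (l : List (Option Bool)) : Function.update (Memory.stacks (m, b)) (some o) l =
      Memory.stacks (Function.update m o l, b) := by
  funext k
  rcases k with _ | k
  · exact Function.update_of_ne (by simp) _ _
  · by_cases h : k = o
    · subst h
      exact (Function.update_self _ _ _).trans (Function.update_self k l m).symm
    · refine (Function.update_of_ne (by simpa using h) _ _).trans ?_
      show m k = Function.update m o l k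
      exact (Function.update_of_ne h l m).symm

theorem Memory.update_none (m : Own → List (Option Bool)) (b : List Bool) (l : List Bool) :
    Function.update (Memory.stacks (m, b)) none l = Memory.stacks (m, l) := by
  funext k
  rcases k with _ | k
  · exact Function.update_self _ _ _
  · exact Function.update_of_ne (by simp) _ _

variable {tm}

/-- The program changes the memory from `p` to `p'` in at most `t` steps, leaving the stacks of
the callable machine empty. -/
def Exec (F : Program tm Own) (p : Memory Own) (t : ℕ) (p' : Memory Own) : Prop :=
  F.Runs tm.initialState (sumStacks (fun _ => []) p.stacks) t (sumStacks (fun _ => []) p'.stacks)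

theorem Exec.mono {F : Program tm Own} {p p' : Memory Own} {t u : ℕ} (h : Exec F p t p')
    (htu : t ≤ u) : Exec F p u p' :=
  Fragment.Runs.mono h htu

theorem Exec.seq {F G : Program tm Own} {p p' p'' : Memory Own} {t u : ℕ} (hF : Exec F p t p')
    (hG : Exec G p' u p'') : Exec (F.seq G) p (t + u) p'' :=
  Fragment.Runs.seq hF hG

theorem exec_skip (p : Memory Own) : Exec (Fragment.skip : Program tm Own) p 0 p :=
  Fragment.runs_skip _ _

namespace Program

/-- Push a symbol on a working stack. -/
def push (o : Own) (a : Option Bool) : Program tm Own :=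
  Fragment.push (.inr (some o)) a

/-- Push the answer. -/
def answer (b : Bool) : Program tm Own :=
  Fragment.push (.inr none) b

/-- Pop a symbol from a working stack and branch on it. -/
def popCase (o : Own) (F₀ : Program tm Own) (F : Option Bool → Program tm Own) : Program tm Own :=
  Fragment.popCase (.inr (some o)) id F₀ F

/-- Pop symbols from a working stack until it is empty or a symbol with `isLast` is read. -/
def loop (o : Own) (isLast : Option Bool → Bool) (F : Option Bool → Program tm Own) :
    Program tm Own :=
  Fragment.loop (.inr (some o)) id isLast F

/-- Move the contents of `i` to the input stack of the machine, run the machine, and move its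
output to `o`; both moves reverse the order. -/
def callMachine (e₀ : tm.Γ tm.k₀ ≃ Option Bool) (e₁ : tm.Γ tm.k₁ ≃ Option Bool) (i o : Own) :
    Program tm Own :=
  have := tm.ΛFin
  Fragment.seq
    (Fragment.loop (.inr (some i)) id (fun _ => false) fun a =>
      Fragment.push (.inl tm.k₀) (e₀.symm a)) <|
  Fragment.seq (Fragment.call tm.m tm.main) <|
    Fragment.loop (.inl tm.k₁) e₁ (fun _ => false) fun a => push o a

end Program

open Program

/-! ### Effect of the basic programs on the memory -/

theorem update_work (m : Own → List (Option Bool)) (b : List Bool) (o : Own)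
    (l : List (Option Bool)) (S : ∀ k, List (tm.Γ k)) :
    Function.update (sumStacks S (Memory.stacks (m, b))) (.inr (some o)) l =
      sumStacks S (Memory.stacks (Function.update m o l, b)) := by
  rw [← Memory.update_some]
  exact update_sumStacks_inr _ _ _ _

theorem update_answer (m : Own → List (Option Bool)) (b l : List Bool)
    (S : ∀ k, List (tm.Γ k)) :
    Function.update (sumStacks S (Memory.stacks (m, b))) (.inr none) l =
      sumStacks S (Memory.stacks (m, l)) := by
  rw [← Memory.update_none m b l]
  exact update_sumStacks_inr _ _ _ _

theorem exec_push (o : Own) (a : Option Bool) (m : Own → List (Option Bool)) (b : List Bool) :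
    Exec (push o a : Program tm Own) (m, b) 0 (Function.update m o (a :: m o), b) :=
  (Fragment.runs_push _ _ _ _).congr rfl (update_work m b o (a :: m o) _)

theorem exec_answer (c : Bool) (m : Own → List (Option Bool)) (b : List Bool) :
    Exec (answer c : Program tm Own) (m, b) 0 (m, c :: b) :=
  (Fragment.runs_push _ _ _ _).congr rfl (update_answer m b (c :: b) _)

theorem exec_popCase_nil {o : Own} {F₀ : Program tm Own} {F : Option Bool → Program tm Own}
    {p p' : Memory Own} {t : ℕ} (ho : p.1 o = []) (h : Exec F₀ p t p') :
    Exec (popCase o F₀ F) p t p' :=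
  Fragment.runs_popCase_nil ho h

theorem exec_popCase_cons {o : Own} {F₀ : Program tm Own} {F : Option Bool → Program tm Own}
    {m : Own → List (Option Bool)} {b : List Bool} {p' : Memory Own} {t : ℕ} {a : Option Bool}
    {l : List (Option Bool)} (ho : m o = a :: l)
    (h : Exec (F a) (Function.update m o l, b) t p') : Exec (popCase o F₀ F) (m, b) t p' := by
  exact Fragment.runs_popCase_cons (Γ := Sum.elim tm.Γ (workAlphabet Own))
    (k := .inr (some o)) (a := a) (l := l) ho
    (h.congr (update_work m b o l _).symm rfl)

theorem exec_loop_nil {o : Own} {isLast : Option Bool → Bool} {F : Option Bool → Program tm Own}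
    {p : Memory Own} (ho : p.1 o = []) : Exec (loop o isLast F) p 1 p :=
  Fragment.runs_loop_nil ho

theorem exec_loop_last {o : Own} {isLast : Option Bool → Bool} {F : Option Bool → Program tm Own}
    {m : Own → List (Option Bool)} {b : List Bool} {a : Option Bool} {l : List (Option Bool)}
    (ho : m o = a :: l) (ha : isLast a = true) :
    Exec (loop o isLast F) (m, b) 1 (Function.update m o l, b) := by
  exact (Fragment.runs_loop_last (Γ := Sum.elim tm.Γ (workAlphabet Own))
    (k := .inr (some o)) (a := a) (l := l) ho ha).congr rfl
    (update_work m b o l _)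

theorem exec_loop_cons {o : Own} {isLast : Option Bool → Bool} {F : Option Bool → Program tm Own}
    {m : Own → List (Option Bool)} {b : List Bool} {p' p'' : Memory Own} {t u : ℕ}
    {a : Option Bool} {l : List (Option Bool)} (ho : m o = a :: l) (ha : isLast a = false)
    (hF : Exec (F a) (Function.update m o l, b) t p') (hloop : Exec (loop o isLast F) p' u p'') :
    Exec (loop o isLast F) (m, b) (1 + t + u) p'' := by
  exact Fragment.runs_loop_cons (Γ := Sum.elim tm.Γ (workAlphabet Own))
    (k := .inr (some o)) (a := a) (l := l) ho ha
    (hF.congr (update_work m b o l _).symm rfl) hloop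

/-- A loop that reads the whole stack. The memory `st d l` is the one after the symbols `d` (the
last one first) have been read and with `l` still to be read. -/
theorem exec_loop {o : Own} {F : Option Bool → Program tm Own} {b : List Bool} {t : ℕ}
    (st : List (Option Bool) → List (Option Bool) → Own → List (Option Bool))
    (hst : ∀ d l, st d l o = l) (w : List (Option Bool))
    (hF : ∀ d a l, d.reverse ++ a :: l = w →
      Exec (F a) (Function.update (st d (a :: l)) o l, b) t (st (a :: d) l, b)) :
    Exec (loop o (fun _ => false) F) (st [] w, b) ((1 + t) * w.length + 1)
      (st w.reverse [], b) := by
  have key : ∀ (l d : List (Option Bool)), d.reverse ++ l = w →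
      Exec (loop o (fun _ => false) F) (st d l, b) ((1 + t) * l.length + 1)
        (st (l.reverse ++ d) [], b) := by
    intro l
    induction l with
    | nil =>
      intro d _
      exact (exec_loop_nil (hst d [])).mono (by omega)
    | cons a l ih =>
      intro d hd
      have h := exec_loop_cons (isLast := fun _ => false) (hst d (a :: l)) rfl (hF d a l hd)
        (ih (a :: d) (by simpa using hd))
      rw [List.reverse_cons, List.append_assoc]
      exact h.mono (by rw [List.length_cons]; ring_nf; omega)
  simpa using key w [] (by simp)

/-- A loop that reads a stack up to the first symbol with `isLast`. -/
theorem exec_loop_until {o : Own} {isLast : Option Bool → Bool} {F : Option Bool → Program tm Own}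
    {b : List Bool} {t : ℕ}
    (st : List (Option Bool) → List (Option Bool) → Own → List (Option Bool))
    {z : Option Bool} (hz : isLast z = true) (rest : List (Option Bool))
    (hst : ∀ d l, st d l o = l ++ z :: rest) (w : List (Option Bool))
    (hw : ∀ a ∈ w, isLast a = false)
    (hF : ∀ d a l, d.reverse ++ a :: l = w →
      Exec (F a) (Function.update (st d (a :: l)) o (l ++ z :: rest), b) t (st (a :: d) l, b)) :
    Exec (loop o isLast F) (st [] w, b) ((1 + t) * w.length + 1)
      (Function.update (st w.reverse []) o rest, b) := by
  have key : ∀ (l d : List (Option Bool)), d.reverse ++ l = w →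
      Exec (loop o isLast F) (st d l, b) ((1 + t) * l.length + 1)
        (Function.update (st (l.reverse ++ d) []) o rest, b) := by
    intro l
    induction l with
    | nil =>
      intro d _
      exact (exec_loop_last (hst d []) hz).mono (by omega)
    | cons a l ih =>
      intro d hd
      have ha : isLast a = false := hw a (by rw [← hd]; simp)
      have h := exec_loop_cons (hst d (a :: l)) ha (hF d a l hd)
        (ih (a :: d) (by simpa using hd))
      rw [List.reverse_cons, List.append_assoc]
      exact h.mono (by rw [List.length_cons]; ring_nf; omega)
  simpa using key w [] (by simp)

theorem initList_eq (w : List (tm.Γ tm.k₀)) :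
    initList tm w =
      ⟨some tm.main, tm.initialState, Function.update (fun _ => []) tm.k₀ w⟩ := by
  unfold initList
  congr 1
  funext k
  by_cases h : k = tm.k₀
  · subst h
    simp
  · simp [h]

theorem haltList_eq (w : List (tm.Γ tm.k₁)) :
    haltList tm w = ⟨none, tm.initialState, Function.update (fun _ => []) tm.k₁ w⟩ := by
  unfold haltList
  congr 1
  funext k
  by_cases h : k = tm.k₁
  · subst h
    simp
  · simp [h]

/-- The argument is stored backwards, which is how a program that writes a word by pushing leaves
it. The result comes back reversed, which is harmless where only its separators are counted. -/
theorem exec_callMachine {e₀ : tm.Γ tm.k₀ ≃ Option Bool} {e₁ : tm.Γ tm.k₁ ≃ Option Bool}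
    {i o : Own} {m : Own → List (Option Bool)} {b : List Bool} {w w' : List (Option Bool)}
    {t : ℕ} (hm : m i = w.reverse)
    (h : TM2OutputsInTime tm (w.map e₀.symm) (some (w'.map e₁.symm)) t) :
    Exec (callMachine e₀ e₁ i o) (m, b) ((w.length + 1) + (t + (w'.length + 1)))
      (Function.update (Function.update m i []) o
        (w'.reverse ++ Function.update m i [] o), b) := by
  -- Here `l'` is the part of the word already on the input stack of the machine.
  have hin : ∀ (l l' : List (Option Bool)) (m : Own → List (Option Bool)), m i = l →
      Fragment.Runs (Γ := Sum.elim tm.Γ (workAlphabet Own))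
        (Fragment.loop (.inr (some i)) id (fun _ => false) fun a =>
          Fragment.push (.inl tm.k₀) (e₀.symm a)) tm.initialState
        (sumStacks (Function.update (fun _ => []) tm.k₀ (l'.map e₀.symm)) (Memory.stacks (m, b)))
        (l.length + 1)
        (sumStacks (Function.update (fun _ => []) tm.k₀ ((l.reverse ++ l').map e₀.symm))
          (Memory.stacks (Function.update m i [], b))) := by
    intro l
    induction l with
    | nil =>
      intro l' m hm
      have : Function.update m i [] = m := by rw [← hm, Function.update_eq_self]
      rw [this]
      exact (Fragment.runs_loop_nil (Γ := Sum.elim tm.Γ (workAlphabet Own)) (k := .inr (some i))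
        hm).mono (by rw [List.length_nil])
    | cons a l ih =>
      intro l' m hm
      have h1 := ih (a :: l') (Function.update m i l) (Function.update_self _ _ _)
      rw [Function.update_idem] at h1
      have h3 : Function.update (Function.update (fun _ => []) tm.k₀ (l'.map e₀.symm)) tm.k₀
          (e₀.symm a :: Function.update (fun _ => []) tm.k₀ (l'.map e₀.symm) tm.k₀) =
          Function.update (fun _ => []) tm.k₀ ((a :: l').map e₀.symm) := by simp
      have h4 := (Fragment.runs_push (Γ := Sum.elim tm.Γ (workAlphabet Own)) (.inl tm.k₀)
        (e₀.symm a) tm.initialState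
        (sumStacks (Function.update (fun _ => []) tm.k₀ (l'.map e₀.symm))
          (Memory.stacks (Function.update m i l, b)))).congr (update_work m b i l _).symm
        ((update_sumStacks_inl _ _ _ _).trans (congrArg (fun S => sumStacks S _) h3))
      have h5 := Fragment.runs_loop_cons (Γ := Sum.elim tm.Γ (workAlphabet Own))
        (k := .inr (some i)) (d := id) (isLast := fun _ => false)
        (F := fun a => Fragment.push (.inl tm.k₀) (e₀.symm a)) (a := a) (l := l)
        (S := sumStacks (Function.update (fun _ => []) tm.k₀ (l'.map e₀.symm))
          (Memory.stacks (m, b))) hm rfl h4 h1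
      rw [List.reverse_cons, List.append_assoc]
      exact h5.mono (by rw [List.length_cons]; omega)
  have hout : ∀ (l : List (Option Bool)) (m : Own → List (Option Bool)),
      Fragment.Runs (Γ := Sum.elim tm.Γ (workAlphabet Own))
        (Fragment.loop (.inl tm.k₁) e₁ (fun _ => false) fun a => (push o a : Program tm Own))
        tm.initialState
        (sumStacks (Function.update (fun _ => []) tm.k₁ (l.map e₁.symm)) (Memory.stacks (m, b)))
        (l.length + 1)
        (sumStacks (fun _ => []) (Memory.stacks (Function.update m o (l.reverse ++ m o), b))) := by
    intro l
    induction l with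
    | nil =>
      intro m
      have h1 : Function.update (fun k => ([] : List (tm.Γ k))) tm.k₁ (([] : List _).map e₁.symm) =
        fun _ => [] := Function.update_eq_self _ _
      simp only [List.reverse_nil, List.nil_append, Function.update_eq_self]
      rw [h1]
      exact (Fragment.runs_loop_nil rfl).mono (by simp)
    | cons a l ih =>
      intro m
      have h1 := ih (Function.update m o (a :: m o))
      rw [Function.update_idem, Function.update_self] at h1
      have h5 : Function.update (sumStacks (Function.update (fun _ => []) tm.k₁
            ((a :: l).map e₁.symm)) (Memory.stacks (m, b))) (.inl tm.k₁) (l.map e₁.symm) =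
          sumStacks (Function.update (fun _ => []) tm.k₁ (l.map e₁.symm))
            (Memory.stacks (m, b)) :=
        (update_sumStacks_inl _ _ _ _).trans
          (congrArg (fun S => sumStacks S _) (Function.update_idem _ _ _))
      have h4 := (Fragment.runs_push (Γ := Sum.elim tm.Γ (workAlphabet Own)) (.inr (some o))
        a tm.initialState (sumStacks (Function.update (fun _ => []) tm.k₁ (l.map e₁.symm))
          (Memory.stacks (m, b)))).congr h5.symm (update_work m b o (a :: m o) _)
      have h6 := Fragment.runs_loop_cons (Γ := Sum.elim tm.Γ (workAlphabet Own))
        (k := .inl tm.k₁) (d := e₁) (isLast := fun _ => false)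
        (F := fun a => (push o a : Program tm Own)) (a := e₁.symm a) (l := l.map e₁.symm)
        (S := sumStacks (Function.update (fun _ => []) tm.k₁ ((a :: l).map e₁.symm))
          (Memory.stacks (m, b))) (by simp [sumStacks]) rfl
        (by rw [Equiv.apply_symm_apply]; exact h4) h1
      rw [List.reverse_cons, List.append_assoc]
      exact h6.mono (by rw [List.length_cons]; omega)
  obtain ⟨⟨t', ht'⟩, hle⟩ := h
  rw [initList_eq, Option.map_some, haltList_eq] at ht'
  have := tm.ΛFin
  have hcall := Fragment.runs_call (Memory.stacks (Function.update m i [], b)) ht'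
  have h1 := hin w.reverse [] m hm
  rw [List.reverse_reverse, List.append_nil, List.length_reverse] at h1
  have h0 : Function.update (fun k => ([] : List (tm.Γ k))) tm.k₀ (([] : List _).map e₀.symm) =
    fun _ => [] := Function.update_eq_self _ _
  rw [h0] at h1
  exact Fragment.Runs.seq h1 (Fragment.Runs.seq (hcall.mono hle)
    (hout w' (Function.update m i [])))

/-! ### The machine of a program -/

/-- The Turing machine that executes a program. -/
def Program.machine [Fintype Own] (F : Program tm Own) (i : Own) : FinTM2 where
  K := tm.K ⊕ Option Own
  kFin := @instFintypeSum _ _ tm.kFin inferInstance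
  k₀ := .inr (some i)
  k₁ := .inr none
  Γ := Sum.elim tm.Γ (workAlphabet Own)
  Λ := Unit ⊕ F.Label
  main := .inl ()
  ΛFin := @instFintypeSum _ _ _ F.finLabel
  σ := RegState tm.σ
  initialState := (tm.initialState, none)
  σFin := @instFintypeProd _ _ tm.σFin inferInstance
  Γk₀Fin := inferInstanceAs (Fintype (Option Bool))
  m
    | .inl _ => F.entry .inr .halt
    | .inr l => F.code .inr .halt l

/-- A program that turns the input word into the answer gives a machine with this output. -/
theorem Program.machine_outputs [Fintype Own] (F : Program tm Own) (i : Own)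
    {w : List (Option Bool)} {c : Bool} {t : ℕ}
    (h : Exec F (Function.update (fun _ => []) i w, []) t (fun _ => [], [c])) :
    Nonempty (TM2OutputsInTime (F.machine i) w (some [c]) (t + 1)) := by
  obtain ⟨t', ht', h'⟩ := h _ (F.machine i).m .inr .halt (fun _ => rfl)
  have h0 := update_work (tm := tm) (fun _ : Own => []) [] i w (fun _ => [])
  have h1 := update_answer (tm := tm) (fun _ : Own => []) [] [c] (fun _ => [])
  rw [sumStacks_nil] at h0 h1
  -- The additional step leads from the start label to the entry of the program.
  refine ⟨⟨⟨t' + 1, ?_⟩, Nat.succ_le_succ ht'⟩⟩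
  refine (congrArg (fun c => (flip bind (F.machine i).step)^[t' + 1] (some c))
    (initList_eq (tm := F.machine i) w)).trans ?_
  refine Eq.trans ?_ (congrArg some (haltList_eq (tm := F.machine i) [c])).symm
  refine (Fragment.iterate_bind_succ (F.machine i).step t' (b := stepAux
    (F.entry (Λ := Unit ⊕ F.Label) .inr .halt) (tm.initialState, none)
    (Function.update (fun _ => []) (.inr (some i)) w)) rfl).trans ?_
  exact (congrArg (fun S => (flip bind (F.machine i).step)^[t'] (some (stepAux
    (F.entry (Λ := Unit ⊕ F.Label) .inr .halt) (tm.initialState, none) S))) h0).trans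
    (h'.trans (congrArg (fun S => some (Cfg.mk none (tm.initialState, none) S)) h1.symm))

end WorkingMemory

/-! ### The working stacks of the decision program -/

section DecisionProgram

open Turing

/-- The working stacks: the input, the number of rows in unary, two counters, a buffer, the row
that is being processed and its reversal, a flag, the word for the amplified complex, and the
number of its rows in unary. -/
inductive Stack
  | inp | cnt | c1 | c2 | buf | row | rev | flag | out | tally
  deriving DecidableEq

instance : Fintype Stack :=
  .ofList [.inp, .cnt, .c1, .c2, .buf, .row, .rev, .flag, .out, .tally]
    fun o => by cases o <;> simp

/-- The contents of the working stacks. -/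
structure Regs where
  inp : List (Option Bool) := []
  cnt : List (Option Bool) := []
  c1 : List (Option Bool) := []
  c2 : List (Option Bool) := []
  buf : List (Option Bool) := []
  row : List (Option Bool) := []
  rev : List (Option Bool) := []
  flag : List (Option Bool) := []
  out : List (Option Bool) := []
  tally : List (Option Bool) := []

namespace Regs

/-- The contents of one stack. -/
def get (r : Regs) : Stack → List (Option Bool)
  | .inp => r.inp
  | .cnt => r.cnt
  | .c1 => r.c1
  | .c2 => r.c2
  | .buf => r.buf
  | .row => r.row
  | .rev => r.rev
  | .flag => r.flag
  | .out => r.out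
  | .tally => r.tally

/-- Replace the contents of one stack. -/
def set (r : Regs) (o : Stack) (l : List (Option Bool)) : Regs :=
  match o with
  | .inp => { r with inp := l }
  | .cnt => { r with cnt := l }
  | .c1 => { r with c1 := l }
  | .c2 => { r with c2 := l }
  | .buf => { r with buf := l }
  | .row => { r with row := l }
  | .rev => { r with rev := l }
  | .flag => { r with flag := l }
  | .out => { r with out := l }
  | .tally => { r with tally := l }

theorem get_set_self (r : Regs) (o : Stack) (l : List (Option Bool)) : (r.set o l).get o = l := by
  cases o <;> rfl

theorem get_set_of_ne (r : Regs) {o o' : Stack} (h : o' ≠ o) (l : List (Option Bool)) :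
    (r.set o l).get o' = r.get o' := by
  cases o <;> cases o' <;> first | rfl | exact absurd rfl h

theorem set_get (r : Regs) (o : Stack) : r.set o (r.get o) = r := by
  cases o <;> rfl

theorem set_set (r : Regs) (o : Stack) (l l' : List (Option Bool)) :
    (r.set o l).set o l' = r.set o l' := by
  cases o <;> rfl

theorem set_comm (r : Regs) {o o' : Stack} (h : o ≠ o') (l l' : List (Option Bool)) :
    (r.set o l).set o' l' = (r.set o' l').set o l := by
  cases o <;> cases o' <;> first | rfl | exact absurd rfl h

theorem update_get (r : Regs) (o : Stack) (l : List (Option Bool)) :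
    Function.update r.get o l = (r.set o l).get := by
  funext o'
  by_cases h : o' = o
  · subst h
    rw [Function.update_self, get_set_self]
  · rw [Function.update_of_ne h, get_set_of_ne _ h]

end Regs

variable {tm : FinTM2}

/-- The program changes the working stacks from `r` to `r'` in at most `t` steps and leaves the
answer stack alone. -/
def Does (F : Program tm Stack) (r : Regs) (t : ℕ) (r' : Regs) : Prop :=
  ∀ b, Exec F (r.get, b) t (r'.get, b)

namespace Does

theorem mono {F : Program tm Stack} {r r' : Regs} {t u : ℕ} (h : Does F r t r') (htu : t ≤ u) :
    Does F r u r' :=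
  fun b => (h b).mono htu

theorem congr {F : Program tm Stack} {r r' r'' : Regs} {t : ℕ} (h : Does F r t r')
    (e : r' = r'') : Does F r t r'' := e ▸ h

theorem seq {F G : Program tm Stack} {r r' r'' : Regs} {t u : ℕ} (hF : Does F r t r')
    (hG : Does G r' u r'') : Does (F.seq G) r (t + u) r'' :=
  fun b => (hF b).seq (hG b)

theorem skip (r : Regs) : Does (Fragment.skip : Program tm Stack) r 0 r :=
  fun _ => exec_skip _

theorem push (o : Stack) (a : Option Bool) (r : Regs) :
    Does (Program.push o a : Program tm Stack) r 0 (r.set o (a :: r.get o)) := fun b => by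
  rw [← Regs.update_get]
  exact exec_push o a r.get b

theorem popCase_nil {o : Stack} {F₀ : Program tm Stack} {F : Option Bool → Program tm Stack}
    {r r' : Regs} {t : ℕ} (ho : r.get o = []) (h : Does F₀ r t r') :
    Does (Program.popCase o F₀ F) r t r' :=
  fun b => exec_popCase_nil ho (h b)

theorem popCase_cons {o : Stack} {F₀ : Program tm Stack} {F : Option Bool → Program tm Stack}
    {r r' : Regs} {t : ℕ} {a : Option Bool} {l : List (Option Bool)} (ho : r.get o = a :: l)
    (h : Does (F a) (r.set o l) t r') : Does (Program.popCase o F₀ F) r t r' := fun b => by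
  refine exec_popCase_cons ho ?_
  rw [Regs.update_get]
  exact h b

theorem loop_nil {o : Stack} {isLast : Option Bool → Bool} {F : Option Bool → Program tm Stack}
    {r : Regs} (ho : r.get o = []) : Does (Program.loop o isLast F) r 1 r :=
  fun _ => exec_loop_nil ho

theorem loop_cons {o : Stack} {isLast : Option Bool → Bool} {F : Option Bool → Program tm Stack}
    {r r' r'' : Regs} {t u : ℕ} {a : Option Bool} {l : List (Option Bool)}
    (ho : r.get o = a :: l) (ha : isLast a = false) (hF : Does (F a) (r.set o l) t r')
    (hloop : Does (Program.loop o isLast F) r' u r'') :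
    Does (Program.loop o isLast F) r (1 + t + u) r'' := fun b => by
  refine exec_loop_cons ho ha ?_ (hloop b)
  rw [Regs.update_get]
  exact hF b

theorem loop {o : Stack} {F : Option Bool → Program tm Stack} {t : ℕ}
    (st : List (Option Bool) → List (Option Bool) → Regs) (hst : ∀ d l, (st d l).get o = l)
    (w : List (Option Bool))
    (hF : ∀ d a l, d.reverse ++ a :: l = w →
      Does (F a) ((st d (a :: l)).set o l) t (st (a :: d) l)) :
    Does (Program.loop o (fun _ => false) F) (st [] w) ((1 + t) * w.length + 1)
      (st w.reverse []) := fun b => by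
  refine exec_loop (fun d l => (st d l).get) hst w fun d a l h => ?_
  rw [Regs.update_get]
  exact hF d a l h b

theorem loop_until {o : Stack} {isLast : Option Bool → Bool} {F : Option Bool → Program tm Stack}
    {t : ℕ} (st : List (Option Bool) → List (Option Bool) → Regs) {z : Option Bool}
    (hz : isLast z = true) (rest : List (Option Bool))
    (hst : ∀ d l, (st d l).get o = l ++ z :: rest) (w : List (Option Bool))
    (hw : ∀ a ∈ w, isLast a = false)
    (hF : ∀ d a l, d.reverse ++ a :: l = w →
      Does (F a) ((st d (a :: l)).set o (l ++ z :: rest)) t (st (a :: d) l)) :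
    Does (Program.loop o isLast F) (st [] w) ((1 + t) * w.length + 1)
      ((st w.reverse []).set o rest) := fun b => by
  rw [← Regs.update_get]
  refine exec_loop_until (fun d l => (st d l).get) hz rest hst w hw fun d a l h => ?_
  rw [Regs.update_get]
  exact hF d a l h b

end Does

namespace Program

/-- Move the contents of `o` to `o'`, in reverse order. -/
def move (o o' : Stack) : Program tm Stack :=
  loop o (fun _ => false) fun a => push o' a

/-- Clear a stack. -/
def clear (o : Stack) : Program tm Stack :=
  loop o (fun _ => false) fun _ => Fragment.skip

end Program

theorem does_move {o o' : Stack} (h : o ≠ o') (r : Regs) :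
    Does (Program.move o o' : Program tm Stack) r ((r.get o).length + 1)
      ((r.set o []).set o' ((r.get o).reverse ++ r.get o')) := by
  have key := Does.loop (tm := tm) (o := o) (F := fun a => Program.push o' a) (t := 0)
    (fun d l => (r.set o l).set o' (d ++ r.get o'))
    (fun d l => by rw [Regs.get_set_of_ne _ h, Regs.get_set_self]) (r.get o)
    (fun d a l _ => (Does.push o' a _).congr (by
      rw [Regs.get_set_of_ne _ h.symm, Regs.get_set_self, ← Regs.set_comm _ h, Regs.set_set,
        Regs.set_set]
      rfl))
  simp only [List.nil_append, Regs.set_get] at key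
  exact key.mono (by omega)

theorem does_clear (o : Stack) (r : Regs) :
    Does (Program.clear o : Program tm Stack) r ((r.get o).length + 1) (r.set o []) := by
  have key := Does.loop (tm := tm) (o := o) (F := fun _ => Fragment.skip) (t := 0)
    (fun _ l => r.set o l) (fun d l => Regs.get_set_self _ _ _) (r.get o)
    (fun d a l _ => (Does.skip _).congr (Regs.set_set _ _ _ _))
  simp only [Regs.set_get] at key
  exact key.mono (by omega)

/-! ### Unary arithmetic -/

namespace Program

/-- Push a mark on `cnt` for each separator of the input word. -/
def countRows : Program tm Stack :=
  Fragment.seq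
    (loop .inp (fun _ => false) fun a =>
      Fragment.seq (push .buf a) (if a = none then push .cnt none else Fragment.skip))
    (move .buf .inp)

/-- Multiply the number of marks on `c2` by the number of marks on `cnt`. -/
def multiply : Program tm Stack :=
  Fragment.seq
    (loop .c2 (fun _ => false) fun _ =>
      Fragment.seq
        (loop .cnt (fun _ => false) fun a => Fragment.seq (push .buf a) (push .c1 none))
        (move .buf .cnt))
    (move .c1 .c2)

/-- Multiply `j` times. -/
def multiplyIter : ℕ → Program tm Stack
  | 0 => Fragment.skip
  | j + 1 => Fragment.seq (multiplyIter j) multiply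

end Program

/-- A stack with `n` marks. -/
abbrev marks (n : ℕ) : List (Option Bool) := List.replicate n none

theorem does_countRows (r : Regs) (h1 : r.buf = []) (h2 : r.cnt = []) :
    Does (Program.countRows : Program tm Stack) r (2 * r.inp.length + 2)
      { r with cnt := marks (r.inp.count none) } := by
  obtain ⟨w, cnt, c1, c2, buf, row, rev, flag, out, tally⟩ := r
  obtain rfl : buf = [] := h1
  obtain rfl : cnt = [] := h2
  have h := (Does.loop (tm := tm) (o := .inp) (F := fun a => Fragment.seq (Program.push .buf a)
      (if a = none then Program.push .cnt none else Fragment.skip)) (t := 0)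
    (fun d l => ⟨l, marks (d.count none), c1, c2, d, row, rev, flag, out, tally⟩)
    (fun _ _ => rfl) w fun d a l _ => by
      refine (Does.push .buf a _).seq (u := 0) ?_
      cases a with
      | none =>
        rw [if_pos rfl]
        refine (Does.push .cnt none _).congr ?_
        rw [List.count_cons_self]
        rfl
      | some a =>
        rw [if_neg (by simp)]
        refine (Does.skip _).congr ?_
        rw [List.count_cons_of_ne (by simp)]
        rfl).seq (does_move (o := .buf) (o' := .inp) (by decide) _)
  refine (h.congr ?_).mono ?_
  · simp [Regs.get, Regs.set]
  · simp only [Regs.get, List.length_reverse]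
    omega

/-- Each mark of `c2` adds a copy of `cnt` to `c1`; reading `cnt` destroys it, so its marks are kept
on `buf` and restored. -/
theorem does_multiply (r : Regs) (a b : ℕ) (h1 : r.buf = []) (h2 : r.c1 = [])
    (h3 : r.cnt = marks a) (h4 : r.c2 = marks b) :
    Does (Program.multiply : Program tm Stack) r (3 * b + 3 * (a * b) + 2)
      { r with c2 := marks (a * b) } := by
  obtain ⟨inp, cnt, c1, c2, buf, row, rev, flag, out, tally⟩ := r
  obtain rfl : buf = [] := h1
  obtain rfl : c1 = [] := h2
  obtain rfl : cnt = marks a := h3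
  obtain rfl : c2 = marks b := h4
  have inner : ∀ (k : ℕ) (l : List (Option Bool)),
      Does (Fragment.seq (Program.loop .cnt (fun _ => false) fun a =>
          Fragment.seq (Program.push .buf a) (Program.push .c1 none)) (Program.move .buf .cnt) :
            Program tm Stack)
        ⟨inp, marks a, marks k, l, [], row, rev, flag, out, tally⟩ (2 * a + 2)
        ⟨inp, marks a, marks (k + a), l, [], row, rev, flag, out, tally⟩ := by
    intro k l
    have h := (Does.loop (tm := tm) (o := .cnt) (F := fun a =>
        Fragment.seq (Program.push .buf a) (Program.push .c1 none)) (t := 0)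
      (fun d l' => ⟨inp, l', marks (k + d.length), l, d, row, rev, flag, out, tally⟩)
      (fun _ _ => rfl) (marks a) fun d a l' _ =>
        (Does.push .buf a _).seq ((Does.push .c1 none _).congr (by
          simp [Regs.get, Regs.set, ← add_assoc, List.replicate_succ]))).seq
      (does_move (o := .buf) (o' := .cnt) (by decide) _)
    refine (h.congr ?_).mono ?_
    · simp [Regs.get, Regs.set]
    · simp only [Regs.get, List.length_reverse, List.length_replicate]
      omega
  have h := (Does.loop (tm := tm) (o := .c2) (F := fun _ => Fragment.seq
      (Program.loop .cnt (fun _ => false) fun a =>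
          Fragment.seq (Program.push .buf a) (Program.push .c1 none)) (Program.move .buf .cnt))
      (t := 2 * a + 2)
    (fun d l => ⟨inp, marks a, marks (a * d.length), l, [], row, rev, flag, out, tally⟩)
    (fun _ _ => rfl) (marks b) fun d _ l _ => (inner (a * d.length) l).congr (by
      rw [List.length_cons, Nat.mul_succ])).seq (does_move (o := .c1) (o' := .c2) (by decide) _)
  refine (h.congr ?_).mono ?_
  · simp [Regs.get, Regs.set]
  · simp only [Regs.get, List.length_reverse, List.length_replicate]
    nlinarith

/-- A time bound for `multiplyIter`. -/
def multiplyIterTime (a : ℕ) : ℕ → ℕ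
  | 0 => 0
  | j + 1 => multiplyIterTime a j + (3 * a ^ j + 3 * (a * a ^ j) + 2)

theorem does_multiplyIter (j : ℕ) (r : Regs) (a : ℕ) (h1 : r.buf = []) (h2 : r.c1 = [])
    (h3 : r.cnt = marks a) (h4 : r.c2 = marks 1) :
    Does (Program.multiplyIter j : Program tm Stack) r (multiplyIterTime a j)
      { r with c2 := marks (a ^ j) } := by
  induction j with
  | zero =>
    refine (Does.skip _).congr ?_
    rw [pow_zero, ← h4]
  | succ j ih =>
    refine (ih.seq (does_multiply { r with c2 := marks (a ^ j) } a (a ^ j) h1 h2 h3 rfl)).congr ?_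
    rw [pow_succ']

end DecisionProgram

/-! ### Writing the amplified complex -/

section Emission

open Turing

variable {tm : FinTM2}

namespace Program

/-- Write as many zeros as there are marks on `o`. -/
def zeros (o : Stack) : Program tm Stack :=
  Fragment.seq
    (loop o (fun _ => false) fun a => Fragment.seq (push .buf a) (push .out (some false)))
    (move .buf o)

/-- Write the columns of all copies of a vertex. -/
def emitBlock (b : Option Bool) : Program tm Stack :=
  Fragment.seq (zeros .c1) (Fragment.seq (push .out b) (zeros .c2))

/-- Write the row of the copy of a simplex in the current copy of the complex; `a` tells whether
the simplex contains the base vertex. -/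
def emitRow (a : Option Bool) : Program tm Stack :=
  Fragment.seq (push .out a) <|
  Fragment.seq (loop .row (fun _ => false) fun b => Fragment.seq (push .rev b) (emitBlock b)) <|
  Fragment.seq (move .rev .row) <|
  Fragment.seq (push .out none) (push .tally none)

/-- Write the rows of the copies of a simplex in all copies of the complex. -/
def emitAll (a : Option Bool) : Program tm Stack :=
  Fragment.seq (emitRow a) <|
  Fragment.seq
    (loop .c2 (fun _ => false) fun z => Fragment.seq (push .c1 z) (emitRow a))
    (move .c1 .c2)

/-- Read the rest of a row, and set the flag if it contains a one. -/
def readRow : Program tm Stack :=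
  Fragment.seq
    (loop .inp (fun a => a == none) fun b =>
      Fragment.seq (push .rev b) (if b = some true then push .flag none else Fragment.skip))
    (move .rev .row)

/-- Process a row with first symbol `a`. -/
def processRow (a : Option Bool) : Program tm Stack :=
  Fragment.seq readRow <|
  Fragment.seq
    (if a = some true then
      popCase .flag (emitRow a) fun _ => Fragment.seq (clear .flag) (emitAll a)
    else Fragment.seq (clear .flag) (emitAll a))
    (clear .row)

/-- Process all rows of the input word. -/
def amplify : Program tm Stack :=
  loop .inp (fun _ => false) processRow

end Program

/-- The symbol `b` between `i` and `j` zeros. -/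
def blockWord (i j : ℕ) (b : Option Bool) : List (Option Bool) :=
  List.replicate i (some false) ++ b :: List.replicate j (some false)

/-- The row of the copy of a simplex with index `i`, where `i + j + 1` is the number of copies. -/
def rowWord (i j : ℕ) (a : Option Bool) (T : List (Option Bool)) : List (Option Bool) :=
  a :: T.flatMap (blockWord i j) ++ [none]

/-- The number of copies of a simplex: the base vertex is written only once. -/
def rowCopies (M : ℕ) (a : Option Bool) (T : List (Option Bool)) : ℕ :=
  if a = some true ∧ some true ∉ T then 1 else M + 1

/-- The rows of the copies of a simplex. -/
def rowsWord (M : ℕ) (a : Option Bool) (T : List (Option Bool)) : List (Option Bool) :=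
  (List.range (rowCopies M a T)).flatMap fun i => rowWord i (M - i) a T

/-! ### Correctness and running time of the writing programs -/

theorem does_zeros {o : Stack} (ho : o = .c1 ∨ o = .c2) (r : Regs) (h : r.buf = []) :
    Does (Program.zeros o : Program tm Stack) r (2 * (r.get o).length + 2)
      (r.set .out (List.replicate (r.get o).length (some false) ++ r.out)) := by
  obtain ⟨inp, cnt, c1, c2, buf, row, rev, flag, out, tally⟩ := r
  obtain rfl : buf = [] := h
  rcases ho with rfl | rfl
  · have h := (Does.loop (tm := tm) (o := .c1) (F := fun a =>
        Fragment.seq (Program.push .buf a) (Program.push .out (some false))) (t := 0)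
      (fun d l => ⟨inp, cnt, l, c2, d, row, rev, flag,
        List.replicate d.length (some false) ++ out, tally⟩)
      (fun _ _ => rfl) c1 fun d a l _ =>
        (Does.push .buf a _).seq (Does.push .out (some false) _)).seq
      (does_move (o := .buf) (o' := .c1) (by decide) _)
    refine (h.congr ?_).mono ?_
    · simp [Regs.get, Regs.set]
    · simp only [Regs.get, List.length_reverse]
      omega
  · have h := (Does.loop (tm := tm) (o := .c2) (F := fun a =>
        Fragment.seq (Program.push .buf a) (Program.push .out (some false))) (t := 0)
      (fun d l => ⟨inp, cnt, c1, l, d, row, rev, flag,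
        List.replicate d.length (some false) ++ out, tally⟩)
      (fun _ _ => rfl) c2 fun d a l _ =>
        (Does.push .buf a _).seq (Does.push .out (some false) _)).seq
      (does_move (o := .buf) (o' := .c2) (by decide) _)
    refine (h.congr ?_).mono ?_
    · simp [Regs.get, Regs.set]
    · simp only [Regs.get, List.length_reverse]
      omega

theorem does_emitBlock (b : Option Bool) (r : Regs) (h : r.buf = []) :
    Does (Program.emitBlock b : Program tm Stack) r (2 * (r.c1.length + r.c2.length) + 4)
      { r with out := (blockWord r.c1.length r.c2.length b).reverse ++ r.out } := by
  refine (((does_zeros (.inl rfl) r h).seq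
    ((Does.push .out b _).seq (does_zeros (.inr rfl) _ h))).congr ?_).mono ?_
  · simp [Regs.get, Regs.set, blockWord]
  · simp only [Regs.get, Regs.set]
    omega

/-- A time bound for `emitRow`, with `M + 1` copies and `m` vertices besides the base vertex. -/
def emitTime (M m : ℕ) : ℕ := (2 * M + 6) * m + 2

/-- The marks on `c1` and `c2` count the copies before and after the current one; they give the
zeros on the two sides of each symbol. -/
theorem does_emitRow (a : Option Bool) (r : Regs) (h : r.buf = []) (h' : r.rev = []) :
    Does (Program.emitRow a : Program tm Stack) r (emitTime (r.c1.length + r.c2.length) r.row.length)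
      { r with
        out := (rowWord r.c1.length r.c2.length a r.row).reverse ++ r.out
        tally := none :: r.tally } := by
  obtain ⟨inp, cnt, c1, c2, buf, row, rev, flag, out, tally⟩ := r
  obtain rfl : buf = [] := h
  obtain rfl : rev = [] := h'
  have h := (Does.push (tm := tm) .out a
      ⟨inp, cnt, c1, c2, [], row, [], flag, out, tally⟩).seq
    ((Does.loop (tm := tm) (o := .row) (F := fun b =>
        Fragment.seq (Program.push .rev b) (Program.emitBlock b))
        (t := 2 * (c1.length + c2.length) + 4)
      (fun d l => ⟨inp, cnt, c1, c2, [], l, d, flag,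
        (d.reverse.flatMap (blockWord c1.length c2.length)).reverse ++ a :: out, tally⟩)
      (fun _ _ => rfl) row fun d b l _ =>
        ((Does.push .rev b _).seq ((does_emitBlock b _ rfl).congr (by
          simp [Regs.get, Regs.set]))).mono (by simp [Regs.set])).seq
      ((does_move (o := .rev) (o' := .row) (by decide) _).seq
        ((Does.push .out none _).seq (Does.push .tally none _))))
  refine (h.congr ?_).mono ?_
  · simp [Regs.get, Regs.set, rowWord]
  · simp only [Regs.get, List.length_reverse, emitTime]
    ring_nf
    omega

/-- A time bound for `emitAll`. -/
def emitAllTime (M m : ℕ) : ℕ := (emitTime M m + 2) * (M + 1)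

/-- Moving a mark from `c2` to `c1` advances to the next copy. One row is written before the loop,
so `M` marks yield `M + 1` copies. -/
theorem does_emitAll (a : Option Bool) (r : Regs) (M : ℕ) (h : r.buf = []) (h' : r.rev = [])
    (h1 : r.c1 = []) (h2 : r.c2 = marks M) :
    Does (Program.emitAll a : Program tm Stack) r (emitAllTime M r.row.length)
      { r with
        out := ((List.range (M + 1)).flatMap fun i => rowWord i (M - i) a r.row).reverse ++ r.out
        tally := marks (M + 1) ++ r.tally } := by
  obtain ⟨inp, cnt, c1, c2, buf, row, rev, flag, out, tally⟩ := r
  obtain rfl : buf = [] := h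
  obtain rfl : rev = [] := h'
  obtain rfl : c1 = [] := h1
  obtain rfl : c2 = marks M := h2
  let st : List (Option Bool) → List (Option Bool) → Regs := fun d l =>
    ⟨inp, cnt, d, l, [], row, [], flag,
      ((List.range (d.length + 1)).flatMap fun i => rowWord i (M - i) a row).reverse ++ out,
      marks (d.length + 1) ++ tally⟩
  have h := ((does_emitRow (tm := tm) a
      ⟨inp, cnt, [], marks M, [], row, [], flag, out, tally⟩ rfl rfl).congr
        (r'' := st [] (marks M)) (by simp [st])).seq
    ((Does.loop (tm := tm) (o := .c2) (F := fun z =>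
        Fragment.seq (Program.push .c1 z) (Program.emitRow a)) (t := emitTime M row.length)
      st (fun _ _ => rfl) (marks M) fun d z l hd => by
        have hlen : d.length + (l.length + 1) = M := by
          have := congrArg List.length hd
          simpa using this
        refine (((Does.push .c1 z _).seq (does_emitRow a _ rfl rfl)).congr ?_).mono ?_
        · have e : M - (d.length + 1) = l.length := by omega
          simp only [Regs.get, Regs.set, st, List.length_cons, List.range_succ (n := d.length + 1),
            List.flatMap_append, List.reverse_append, List.append_assoc, List.flatMap_singleton, e]
          rfl
        · simp only [Regs.get, Regs.set, st, List.length_cons, zero_add]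
          rw [show d.length + 1 + l.length = M by omega]).seq
      (does_move (o := .c1) (o' := .c2) (by decide) _))
  refine (h.congr ?_).mono ?_
  · simp [Regs.get, Regs.set, st]
  · simp only [Regs.get, List.length_reverse, emitAllTime, st, List.length_replicate,
      List.length_nil, zero_add]
    ring_nf
    omega

theorem does_readRow (r : Regs) (T rest : List (Option Bool)) (hT : none ∉ T)
    (h : r.inp = T ++ none :: rest) (h1 : r.row = []) (h2 : r.rev = []) (h3 : r.flag = []) :
    Does (Program.readRow : Program tm Stack) r (2 * T.length + 2)
      { r with inp := rest, row := T, flag := marks (T.count (some true)) } := by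
  obtain ⟨inp, cnt, c1, c2, buf, row, rev, flag, out, tally⟩ := r
  obtain rfl : inp = T ++ none :: rest := h
  obtain rfl : row = [] := h1
  obtain rfl : rev = [] := h2
  obtain rfl : flag = [] := h3
  have h := (Does.loop_until (tm := tm) (o := .inp) (isLast := fun a => a == none) (F := fun b =>
      Fragment.seq (Program.push .rev b)
        (if b = some true then Program.push .flag none else Fragment.skip)) (t := 0)
    (fun d l => ⟨l ++ none :: rest, cnt, c1, c2, buf, [], d, marks (d.count (some true)), out,
      tally⟩) (z := none) rfl rest (fun _ _ => rfl) T
      (fun a ha => by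
        cases a with
        | none => exact absurd ha hT
        | some a => rfl)
      fun d b l _ => by
        refine (Does.push .rev b _).seq (u := 0) ?_
        by_cases hb : b = some true
        · subst hb
          rw [if_pos rfl]
          refine (Does.push .flag none _).congr ?_
          rw [List.count_cons_self]
          rfl
        · rw [if_neg hb]
          refine (Does.skip _).congr ?_
          rw [List.count_cons_of_ne hb]
          rfl).seq (does_move (o := .rev) (o' := .row) (by decide) _)
  refine (h.congr ?_).mono ?_
  · simp [Regs.get, Regs.set]
  · simp only [Regs.get, Regs.set, List.length_reverse]
    omega

/-- A time bound for `processRow`. -/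
def processTime (M m : ℕ) : ℕ := 4 * m + 4 + emitAllTime M m

theorem emitTime_le (M m : ℕ) : emitTime M m ≤ emitAllTime M m := by
  unfold emitAllTime
  nlinarith

/-- The flag tells whether a one follows the first symbol. A row whose only one is in front is the
base vertex, which all copies share, so it is written once. -/
theorem does_processRow (a : Option Bool) (r : Regs) (M : ℕ) (T rest : List (Option Bool))
    (hT : none ∉ T) (h : r.inp = T ++ none :: rest) (h1 : r.row = []) (h2 : r.rev = [])
    (h3 : r.flag = []) (h4 : r.buf = []) (h5 : r.c1 = []) (h6 : r.c2 = marks M) :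
    Does (Program.processRow a : Program tm Stack) r (processTime M T.length)
      { r with
        inp := rest
        out := (rowsWord M a T).reverse ++ r.out
        tally := marks (rowCopies M a T) ++ r.tally } := by
  have hread := does_readRow (tm := tm) r T rest hT h h1 h2 h3
  obtain ⟨inp, cnt, c1, c2, buf, row, rev, flag, out, tally⟩ := r
  obtain rfl : inp = T ++ none :: rest := h
  obtain rfl : row = [] := h1
  obtain rfl : rev = [] := h2
  obtain rfl : flag = [] := h3
  obtain rfl : buf = [] := h4
  obtain rfl : c1 = [] := h5
  obtain rfl : c2 = marks M := h6
  have hcount := List.count_le_length (a := some true) (l := T)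
  have hle := emitTime_le M T.length
  have hall : ∀ k : ℕ, k ≤ T.length → rowCopies M a T = M + 1 →
      Does (Fragment.seq (Program.clear .flag) (Program.emitAll a) : Program tm Stack)
      ⟨rest, cnt, [], marks M, [], T, [], marks k, out, tally⟩
      (T.length + 1 + emitAllTime M T.length)
      ⟨rest, cnt, [], marks M, [], T, [], [], (rowsWord M a T).reverse ++ out,
        marks (rowCopies M a T) ++ tally⟩ := by
    intro k hk hc
    refine (((does_clear .flag _).seq (does_emitAll a _ M rfl rfl rfl rfl)).congr ?_).mono ?_
    · simp only [Regs.set, rowsWord, hc]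
    · simp only [Regs.get, Regs.set, List.length_replicate]
      omega
  have hmid : Does (if a = some true then
      Program.popCase .flag (Program.emitRow a) fun _ =>
        Fragment.seq (Program.clear .flag) (Program.emitAll a)
      else Fragment.seq (Program.clear .flag) (Program.emitAll a) : Program tm Stack)
      ⟨rest, cnt, [], marks M, [], T, [], marks (T.count (some true)), out, tally⟩
      (T.length + 1 + emitAllTime M T.length)
      ⟨rest, cnt, [], marks M, [], T, [], [], (rowsWord M a T).reverse ++ out,
        marks (rowCopies M a T) ++ tally⟩ := by
    by_cases ha : a = some true
    · rw [if_pos ha]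
      by_cases hm : some true ∈ T
      · obtain ⟨k, hk⟩ : ∃ k, T.count (some true) = k + 1 :=
          Nat.exists_eq_succ_of_ne_zero (List.count_pos_iff.2 hm).ne'
        rw [hk]
        exact Does.popCase_cons (o := .flag) (a := none) (l := marks k) rfl
          (hall k (by omega) (by simp [rowCopies, hm]))
      · rw [List.count_eq_zero.2 hm]
        refine Does.popCase_nil (o := .flag) rfl (((does_emitRow a _ rfl rfl).congr ?_).mono ?_)
        · simp [rowsWord, rowCopies, ha, hm]
        · simp only [List.length_nil, List.length_replicate, zero_add]
          omega
    · rw [if_neg ha]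
      exact hall _ hcount (by simp [rowCopies, ha])
  refine (hread.seq (hmid.seq (does_clear .row _))).mono ?_
  simp only [Regs.get, processTime]
  omega

/-- The input word with the given rows, each one consisting of a first symbol and the rest. -/
def rowsInput (R : List (Option Bool × List (Option Bool))) : List (Option Bool) :=
  R.flatMap fun x => x.1 :: x.2 ++ [none]

/-- The symbol popped by the loop is the column of the base vertex; it is remembered in the control
as the parameter of `processRow`. -/
theorem does_amplify (R : List (Option Bool × List (Option Bool))) (r : Regs) (M m : ℕ)
    (hR : ∀ x ∈ R, none ∉ x.2 ∧ x.2.length = m) (h : r.inp = rowsInput R) (h1 : r.row = [])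
    (h2 : r.rev = []) (h3 : r.flag = []) (h4 : r.buf = []) (h5 : r.c1 = [])
    (h6 : r.c2 = marks M) :
    Does (Program.amplify : Program tm Stack) r ((1 + processTime M m) * R.length + 1)
      { r with
        inp := []
        out := (R.flatMap fun x => rowsWord M x.1 x.2).reverse ++ r.out
        tally := marks (R.map fun x => rowCopies M x.1 x.2).sum ++ r.tally } := by
  induction R generalizing r with
  | nil =>
    refine ((Does.loop_nil (o := .inp) h).congr ?_).mono (by simp)
    obtain ⟨inp, cnt, c1, c2, buf, row, rev, flag, out, tally⟩ := r
    obtain rfl : inp = [] := h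
    rfl
  | cons x R ih =>
    obtain ⟨a, T⟩ := x
    have hx := hR (a, T) (by simp)
    have hstep := does_processRow (tm := tm) a (r.set .inp (T ++ none :: rowsInput R)) M T
      (rowsInput R) hx.1 rfl h1 h2 h3 h4 h5 h6
    have hrest := ih { (r.set .inp (T ++ none :: rowsInput R)) with
        inp := rowsInput R
        out := (rowsWord M a T).reverse ++ r.out
        tally := marks (rowCopies M a T) ++ r.tally }
      (fun y hy => hR y (by simp [hy])) rfl h1 h2 h3 h4 h5 h6
    have hinp : r.get .inp = a :: (T ++ none :: rowsInput R) := by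
      show r.inp = _
      rw [h]
      simp [rowsInput]
    have := Does.loop_cons (isLast := fun _ => false) hinp rfl hstep hrest
    refine (this.congr ?_).mono ?_
    · obtain ⟨inp, cnt, c1, c2, buf, row, rev, flag, out, tally⟩ := r
      simp only [Regs.set, List.flatMap_cons, List.reverse_append, List.append_assoc, List.map_cons,
        List.sum_cons]
      rw [← List.append_assoc (marks _), List.replicate_append_replicate, Nat.add_comm]
    · rw [hx.2, List.length_cons]
      ring_nf
      omega

end Emission

/-! ### The decision program -/

section Decision

open Turing

variable {tm : FinTM2}

namespace Program

/-- Remove a mark from `tally` for each separator on `buf`. -/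
def deduct : Program tm Stack :=
  loop .buf (fun _ => false) fun a =>
    if a = none then popCase .tally Fragment.skip fun _ => Fragment.skip else Fragment.skip

/-- Answer whether `tally` has at most as many marks as `c2`, and clear all stacks. -/
def compare : Program tm Stack :=
  Fragment.seq
    (loop .tally (fun _ => false) fun _ =>
      popCase .c2 (push .flag none) fun _ => Fragment.skip) <|
  Fragment.seq (clear .c2) <|
  Fragment.seq (clear .cnt) <|
    popCase .flag (answer true) fun _ => Fragment.seq (clear .flag) (answer false)

/-- Write the amplified complex with exponent `j + 1`, run the machine on it, and decide whether
its output leaves fewer critical simplices than there are copies. -/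
def decideLarge (e₀ : tm.Γ tm.k₀ ≃ Option Bool) (e₁ : tm.Γ tm.k₁ ≃ Option Bool) (j : ℕ) :
    Program tm Stack :=
  Fragment.seq countRows <|
  Fragment.seq (push .c2 none) <|
  Fragment.seq (multiplyIter j) <|
  Fragment.seq (popCase .c2 Fragment.skip fun _ => Fragment.skip) <|
  Fragment.seq amplify <|
  Fragment.seq (callMachine e₀ e₁ .out .buf) <|
  Fragment.seq deduct compare

/-- Push a list of symbols, the first one first. -/
def pushAll (o : Stack) : List (Option Bool) → Program tm Stack
  | [] => Fragment.skip
  | a :: l => Fragment.seq (push o a) (pushAll o l)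

/-- Answer by table look-up if the input word has fewer than `d` symbols; otherwise execute `F`.
The symbols read so far are `pre`, the last one first. -/
def lookup (table : List (Option Bool) → Bool) (F : Program tm Stack) :
    ℕ → List (Option Bool) → Program tm Stack
  | 0, pre => Fragment.seq (pushAll .inp pre) F
  | d + 1, pre => popCase .inp (answer (table pre.reverse)) fun a => lookup table F d (a :: pre)

end Program

/-! ### Correctness and running time of the decision program -/

theorem does_deduct (r : Regs) (k : ℕ) (h : r.tally = marks k) :
    Does (Program.deduct : Program tm Stack) r (r.buf.length + 1)
      { r with buf := [], tally := marks (k - r.buf.count none) } := by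
  obtain ⟨inp, cnt, c1, c2, buf, row, rev, flag, out, tally⟩ := r
  obtain rfl : tally = marks k := h
  have h := Does.loop (tm := tm) (o := .buf) (F := fun a => if a = none then
      Program.popCase .tally Fragment.skip fun _ => Fragment.skip else Fragment.skip) (t := 0)
    (fun d l => ⟨inp, cnt, c1, c2, l, row, rev, flag, out, marks (k - d.count none)⟩)
    (fun _ _ => rfl) buf fun d a l _ => by
      by_cases ha : a = none
      · subst ha
        rw [if_pos rfl, List.count_cons_self]
        rcases hk : k - d.count none with _ | k'
        · rw [show k - (d.count none + 1) = 0 by omega]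
          exact Does.popCase_nil rfl (Does.skip _)
        · rw [show k - (d.count none + 1) = k' by omega]
          exact Does.popCase_cons (o := .tally) (a := none) (l := marks k') rfl (Does.skip _)
      · rw [if_neg ha, List.count_cons_of_ne ha]
        exact Does.skip _
  refine (h.congr ?_).mono (by simp)
  simp

/-- Marks of `tally` and `c2` are cancelled against each other and the surplus of `tally` goes to
`flag`, so an empty flag means `k ≤ M`. -/
theorem exec_compare (r : Regs) (k M : ℕ) (h : r.tally = marks k) (h' : r.c2 = marks M)
    (h1 : r.flag = []) :
    Exec (Program.compare : Program tm Stack) (r.get, []) (2 * k + M + r.cnt.length + 4)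
      ({ r with tally := [], c2 := [], cnt := [] }.get, [decide (k ≤ M)]) := by
  obtain ⟨inp, cnt, c1, c2, buf, row, rev, flag, out, tally⟩ := r
  obtain rfl : tally = marks k := h
  obtain rfl : c2 = marks M := h'
  obtain rfl : flag = [] := h1
  have h := (Does.loop (tm := tm) (o := .tally) (F := fun _ =>
      Program.popCase .c2 (Program.push .flag none) fun _ => Fragment.skip) (t := 0)
    (fun d l => ⟨inp, cnt, c1, marks (M - d.length), buf, row, rev, marks (d.length - M), out, l⟩)
    (fun _ _ => rfl) (marks k) fun d a l _ => by
      rw [List.length_cons]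
      rcases hM : M - d.length with _ | M'
      · rw [show M - (d.length + 1) = 0 by omega,
          show d.length + 1 - M = (d.length - M) + 1 by omega]
        exact Does.popCase_nil (o := .c2) rfl (Does.push .flag none _)
      · rw [show M - (d.length + 1) = M' by omega, show d.length + 1 - M = 0 by omega,
          show d.length - M = 0 by omega]
        exact Does.popCase_cons (o := .c2) (a := none) (l := marks M') rfl (Does.skip _))
  have h0 : Does (Program.loop .tally (fun _ => false) fun _ =>
      Program.popCase .c2 (Program.push .flag none) fun _ => Fragment.skip : Program tm Stack)
      ⟨inp, cnt, c1, marks M, buf, row, rev, [], out, marks k⟩ (k + 1)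
      ⟨inp, cnt, c1, marks (M - k), buf, row, rev, marks (k - M), out, []⟩ := by
    simpa using h
  have hlast : Exec (Program.popCase .flag (Program.answer true) fun _ =>
      Fragment.seq (Program.clear .flag) (Program.answer false) : Program tm Stack)
      (Regs.get ⟨inp, [], c1, [], buf, row, rev, marks (k - M), out, []⟩, []) (k + 1)
      (Regs.get ⟨inp, [], c1, [], buf, row, rev, [], out, []⟩, [decide (k ≤ M)]) := by
    rcases hk : k - M with _ | k'
    · rw [decide_eq_true (by omega)]
      exact exec_popCase_nil rfl ((exec_answer true _ _).mono (Nat.zero_le _))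
    · rw [decide_eq_false (by omega)]
      refine exec_popCase_cons (a := none) (l := marks k') rfl ?_
      rw [Regs.update_get]
      refine ((does_clear .flag _ []).seq (exec_answer false _ _)).mono ?_
      simp only [Regs.get, Regs.set, List.length_replicate]
      omega
  refine ((h0 []).seq ((does_clear .c2 _ []).seq ((does_clear .cnt _ []).seq hlast))).mono ?_
  simp only [Regs.get, Regs.set, List.length_replicate]
  omega

/-- A time bound for `decideLarge`: `n` rows of length `m + 1`, an exponent `j`, and a machine
that reads `L` symbols, takes `t` steps and writes `L'` symbols. -/
def decideTime (j n m k L t L' : ℕ) : ℕ :=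
  2 * (n * (m + 2)) + 2 + multiplyIterTime n j + ((1 + processTime (n ^ j) m) * n + 1) +
    (L + t + L' + 2) + (L' + 1) + (2 * k + n ^ j + n + 4)

theorem emitTime_mono {M M' : ℕ} (h : M ≤ M') (m : ℕ) : emitTime M m ≤ emitTime M' m := by
  unfold emitTime
  gcongr

theorem processTime_mono {M M' : ℕ} (h : M ≤ M') (m : ℕ) :
    processTime M m ≤ processTime M' m := by
  unfold processTime emitAllTime
  have := emitTime_mono h m
  gcongr

theorem count_none_rowsInput (R : List (Option Bool × List (Option Bool)))
    (hR : ∀ x ∈ R, x.1 ≠ none ∧ none ∉ x.2) : (rowsInput R).count none = R.length := by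
  induction R with
  | nil => rfl
  | cons x R ih =>
    have hx := hR x (by simp)
    have := ih fun y hy => hR y (by simp [hy])
    rw [rowsInput] at this ⊢
    rw [List.flatMap_cons, List.count_append, this, List.cons_append,
      List.count_cons_of_ne hx.1, List.count_append, List.count_eq_zero.2 hx.2]
    simp [Nat.add_comm]

theorem length_rowsInput (R : List (Option Bool × List (Option Bool))) {m : ℕ}
    (hR : ∀ x ∈ R, x.2.length = m) : (rowsInput R).length = R.length * (m + 2) := by
  induction R with
  | nil => simp [rowsInput]
  | cons x R ih =>
    have hx := hR x (by simp)
    have := ih fun y hy => hR y (by simp [hy])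
    rw [rowsInput] at this ⊢
    rw [List.flatMap_cons, List.length_append, this]
    simp [hx]
    ring

/-- One mark is removed from `c2`, leaving the number of copies minus one. This is the value that
`emitAll` needs, and it also turns the strict comparison with the number of copies into `≤ M`. -/
theorem exec_decideLarge {e₀ : tm.Γ tm.k₀ ≃ Option Bool} {e₁ : tm.Γ tm.k₁ ≃ Option Bool}
    (j m : ℕ) (R : List (Option Bool × List (Option Bool)))
    (hR : ∀ x ∈ R, x.1 ≠ none ∧ none ∉ x.2 ∧ x.2.length = m) {M : ℕ} (hM : M + 1 = R.length ^ j)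
    {w' : List (Option Bool)} {t : ℕ}
    (htm : Nonempty (TM2OutputsInTime tm
      ((R.flatMap fun x => rowsWord M x.1 x.2).map e₀.symm) (some (w'.map e₁.symm)) t)) :
    Exec (Program.decideLarge e₀ e₁ j) (Regs.get { inp := rowsInput R }, [])
      (decideTime j R.length m ((R.map fun x => rowCopies M x.1 x.2).sum)
        (R.flatMap fun x => rowsWord M x.1 x.2).length t w'.length)
      (fun _ => [],
        [decide ((R.map fun x => rowCopies M x.1 x.2).sum - w'.count none ≤ M)]) := by
  obtain ⟨htm⟩ := htm
  set W := R.flatMap fun x => rowsWord M x.1 x.2 with hW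
  set s := (R.map fun x => rowCopies M x.1 x.2).sum with hs
  have hcnt := count_none_rowsInput R fun x hx => ⟨(hR x hx).1, (hR x hx).2.1⟩
  have hlen := length_rowsInput R fun x hx => (hR x hx).2.2
  have p1 := does_countRows (tm := tm) { inp := rowsInput R } rfl rfl
  rw [hcnt] at p1
  have p2 := Does.push (tm := tm) .c2 none { inp := rowsInput R, cnt := marks R.length }
  have p3 := does_multiplyIter (tm := tm) j
    { inp := rowsInput R, cnt := marks R.length, c2 := marks 1 } R.length rfl rfl rfl rfl
  rw [← hM] at p3
  have p4 : Does (Program.popCase .c2 Fragment.skip fun _ => Fragment.skip : Program tm Stack)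
      { inp := rowsInput R, cnt := marks R.length, c2 := marks (M + 1) } 0
      { inp := rowsInput R, cnt := marks R.length, c2 := marks M } :=
    Does.popCase_cons (o := .c2) (a := none) (l := marks M) rfl (Does.skip _)
  have p5 := does_amplify (tm := tm) R
    { inp := rowsInput R, cnt := marks R.length, c2 := marks M } M m
    (fun x hx => (hR x hx).2) rfl rfl rfl rfl rfl rfl rfl
  rw [← hW, ← hs, List.append_nil, List.append_nil] at p5
  have p6 := exec_callMachine (e₀ := e₀) (e₁ := e₁) (i := Stack.out) (o := Stack.buf)
    (m := Regs.get { cnt := marks R.length, c2 := marks M, out := W.reverse, tally := marks s })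
    (b := []) rfl htm
  rw [Regs.update_get, Regs.update_get] at p6
  have p7 := does_deduct (tm := tm)
    { cnt := marks R.length, c2 := marks M, buf := w'.reverse ++ [], tally := marks s } s rfl []
  have p8 := exec_compare (tm := tm)
    { cnt := marks R.length, c2 := marks M, tally := marks (s - (w'.reverse ++ []).count none) }
    _ M rfl rfl rfl
  have hnil : ((fun _ => [] : Stack → List (Option Bool))) = Regs.get {} := by
    funext o
    cases o <;> rfl
  have hcount : (w'.reverse ++ []).count none = w'.count none := by
    rw [List.append_nil, List.count_reverse]
  rw [hnil, ← hcount]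
  refine ((p1 []).seq ((p2 []).seq ((p3 []).seq ((p4 []).seq ((p5 []).seq
    (p6.seq (Exec.seq (t := w'.length + 1) ?_ p8))))))).mono ?_
  · exact p7.mono (by simp)
  · simp only [decideTime, hlen, List.length_replicate]
    have := processTime_mono (show M ≤ R.length ^ j by omega) m
    have h2 : (1 + processTime M m) * R.length ≤ (1 + processTime (R.length ^ j) m) * R.length := by
      gcongr
    omega

theorem exec_pushAll (l : List (Option Bool)) (w : List (Option Bool)) :
    Exec (Program.pushAll .inp l : Program tm Stack) (Regs.get { inp := w }, []) 0
      (Regs.get { inp := l.reverse ++ w }, []) := by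
  induction l generalizing w with
  | nil => exact exec_skip _
  | cons a l ih =>
    have h := (Does.push (tm := tm) .inp a { inp := w } []).seq (ih (a :: w))
    rw [List.reverse_cons, List.append_assoc]
    exact h

/-- The table is a tree of pops of depth `d` inside a single statement, so the answer is free of
charge, and the whole input has been consumed. -/
theorem exec_lookup_short (table : List (Option Bool) → Bool) (F : Program tm Stack) (d : ℕ)
    (pre w : List (Option Bool)) (hw : w.length < d) :
    Exec (Program.lookup table F d pre) (Regs.get { inp := w }, []) 0
      (fun _ => [], [table (pre.reverse ++ w)]) := by
  induction d generalizing pre w with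
  | zero => omega
  | succ d ih =>
    cases w with
    | nil =>
      refine exec_popCase_nil rfl ?_
      rw [List.append_nil]
      have hnil : ((fun _ => [] : Stack → List (Option Bool))) = Regs.get {} := by
        funext o
        cases o <;> rfl
      rw [hnil]
      exact exec_answer _ _ _
    | cons a w =>
      refine exec_popCase_cons (a := a) (l := w) rfl ?_
      rw [Regs.update_get]
      have := ih (a :: pre) w (by simpa using hw)
      rw [List.reverse_cons, List.append_assoc] at this
      exact this

theorem exec_lookup_long (table : List (Option Bool) → Bool) {F : Program tm Stack} {d : ℕ}
    {pre w : List (Option Bool)} (hw : d ≤ w.length) {t : ℕ} {p : Memory Stack}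
    (hF : Exec F (Regs.get { inp := pre.reverse ++ w }, []) t p) :
    Exec (Program.lookup table F d pre) (Regs.get { inp := w }, []) t p := by
  induction d generalizing pre w with
  | zero => exact ((exec_pushAll pre w).seq hF).mono (by omega)
  | succ d ih =>
    cases w with
    | nil => simp at hw
    | cons a w =>
      refine exec_popCase_cons (a := a) (l := w) rfl ?_
      rw [Regs.update_get]
      refine ih (by simpa using hw) ?_
      rw [List.reverse_cons, List.append_assoc]
      exact hF

end Decision

/-! ### The amplified complex as an input -/

section AmplifiedInput

variable {m N : ℕ}

/-- The vertex of the amplified complex that corresponds to a vertex of the `i`-th copy, where the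
base vertex is `0`. -/
def copyVertex (m : ℕ) (i : Fin N) : Fin (m + 1) → Fin (m * N + 1) :=
  Fin.cases 0 fun j => (finProdFinEquiv (j, i)).succ

theorem copyVertex_zero (i : Fin N) : copyVertex m i 0 = 0 := rfl

theorem copyVertex_succ (i : Fin N) (j : Fin m) :
    copyVertex m i j.succ = (finProdFinEquiv (j, i)).succ := rfl

/-- The numbering of the vertices of the wedge at the vertex `0`. -/
def wedgeVertexEquiv (m N : ℕ) : WedgeVertex N (0 : Fin (m + 1)) ≃ Fin (m * N + 1) :=
  (Equiv.optionCongr (((Equiv.refl (Fin N)).prodCongr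
    (finSuccAboveEquiv (0 : Fin (m + 1))).symm).trans
      ((Equiv.prodComm _ _).trans finProdFinEquiv))).trans (finSuccEquiv (m * N)).symm

theorem wedgeVertexEquiv_inclusion (i : Fin N) (w : Fin (m + 1)) :
    wedgeVertexEquiv m N (wedgeInclusion N 0 i w) = copyVertex m i w := by
  cases w using Fin.cases with
  | zero => simp [wedgeInclusion, wedgeVertexEquiv, copyVertex_zero]
  | succ j =>
    have h : (finSuccAboveEquiv (0 : Fin (m + 1))).symm ⟨j.succ, Fin.succ_ne_zero j⟩ = j := by
      rw [Equiv.symm_apply_eq]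
      simp [finSuccAboveEquiv_apply]
    simp [wedgeInclusion, wedgeVertexEquiv, copyVertex_succ, h]

theorem isWedgeFamily_copyVertex : IsWedgeFamily (copyVertex (N := N) m) 0 := by
  have h := isWedgeFamily_wedgeInclusion N 0 (wedgeVertexEquiv m N)
  have e : (fun (i : Fin N) w => wedgeVertexEquiv m N (wedgeInclusion N 0 i w)) =
      copyVertex m := by
    funext i w
    exact wedgeVertexEquiv_inclusion i w
  rwa [e] at h

theorem wedge_map_faces (K : AbstractSimplicialComplex (Fin (m + 1))) :
    ((wedge K N 0).map (wedgeVertexEquiv m N)).faces = wedgeFaces (copyVertex m) K.faces := by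
  rw [mem_wedge_map_faces]
  congr 1
  funext i w
  exact wedgeVertexEquiv_inclusion i w

/-- The copies of a simplex that are listed: the base vertex is listed only once. -/
def copyIndices (hN : 0 < N) (s : Finset (Fin (m + 1))) : List (Fin N) :=
  if s = {0} then [⟨0, hN⟩] else List.finRange N

/-- The list of the simplices of the amplified complex. -/
def wedgeSimplices (hN : 0 < N) (l : List (Finset (Fin (m + 1)))) :
    List (Finset (Fin (m * N + 1))) :=
  l.flatMap fun s => (copyIndices hN s).map fun i => s.image (copyVertex m i)

theorem mem_wedgeSimplices (hN : 0 < N) (l : List (Finset (Fin (m + 1))))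
    (t : Finset (Fin (m * N + 1))) :
    t ∈ wedgeSimplices hN l ↔ ∃ i : Fin N, ∃ s ∈ l, s.image (copyVertex m i) = t := by
  simp only [wedgeSimplices, List.mem_flatMap, List.mem_map]
  constructor
  · rintro ⟨s, hs, i, -, rfl⟩
    exact ⟨i, s, hs, rfl⟩
  · rintro ⟨i, s, hs, rfl⟩
    by_cases h : s = {0}
    · refine ⟨s, hs, ⟨0, hN⟩, by simp [copyIndices, h], ?_⟩
      simp [h, copyVertex_zero]
    · exact ⟨s, hs, i, by simp [copyIndices, h], rfl⟩

/-- Different copies share only the base vertex. Listing it once is therefore enough to avoid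
repetitions. -/
theorem nodup_wedgeSimplices (hN : 0 < N) {l : List (Finset (Fin (m + 1)))} (hl : l.Nodup)
    (hne : ∀ s ∈ l, s.Nonempty) : (wedgeSimplices hN l).Nodup := by
  have hφ := isWedgeFamily_copyVertex (m := m) (N := N)
  refine List.nodup_flatMap.2 ⟨fun s hs => ?_, ?_⟩
  · by_cases h : s = {0}
    · simp [copyIndices, h]
    · rw [copyIndices, if_neg h]
      exact (List.nodup_finRange N).map fun i j hij => (hφ.eq_of_image_eq (hne s hs) h hij).1
  · refine List.Pairwise.imp_of_mem ?_ hl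
    intro s t hs ht hst x hx hy
    obtain ⟨i, -, rfl⟩ := List.mem_map.1 hx
    obtain ⟨j, -, hij⟩ := List.mem_map.1 hy
    by_cases h : s = {0}
    · have h' : t ≠ {0} := fun h' => hst (h.trans h'.symm)
      exact hst (hφ.eq_of_image_eq (hne t ht) h' hij).2.symm
    · exact hst (hφ.eq_of_image_eq (hne s hs) h hij.symm).2

/-- The wedge of `N` copies of a complex with its list of simplices. -/
def wedgeInput (hN : 0 < N) (K : AbstractSimplicialComplex (Fin (m + 1)))
    (l : List (Finset (Fin (m + 1)))) (hl : l.Nodup) (hK : ∀ s, s ∈ l ↔ s ∈ K.faces) :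
    ComplexInput where
  numVertices := m * N + 1
  complex :=
    { (wedge K N 0).map (wedgeVertexEquiv m N) with
      singleton_mem := fun v => by
        rw [wedge_map_faces]
        cases v using Fin.cases with
        | zero =>
          refine ⟨⟨0, hN⟩, {0}, K.singleton_mem 0, ?_⟩
          rw [Finset.image_singleton, copyVertex_zero]
        | succ k =>
          obtain ⟨⟨j, i⟩, rfl⟩ := finProdFinEquiv.surjective k
          refine ⟨i, {j.succ}, K.singleton_mem _, ?_⟩
          rw [Finset.image_singleton, copyVertex_succ] }
  simplices := wedgeSimplices hN l
  nodup_simplices := nodup_wedgeSimplices hN hl fun s hs => K.nonempty_of_mem ((hK s).1 hs)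
  mem_simplices t := by
    rw [mem_wedgeSimplices]
    show _ ↔ t ∈ ((wedge K N 0).map (wedgeVertexEquiv m N)).faces
    rw [wedge_map_faces]
    simp only [hK]
    rfl

/-- The row of a simplex: its first symbol and the rest. -/
def rowPair (s : Finset (Fin (m + 1))) : Option Bool × List (Option Bool) :=
  (some (decide (0 ∈ s)), List.ofFn fun j : Fin m => some (decide (j.succ ∈ s)))

theorem map_some_vertexRow (s : Finset (Fin (m + 1))) :
    (vertexRow s).map some = (rowPair s).1 :: (rowPair s).2 := by
  simp [vertexRow, rowPair, List.ofFn_succ, List.map_ofFn, Function.comp_def]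

theorem encodeRows_map_vertexRow (l : List (Finset (Fin (m + 1)))) :
    encodeRows (l.map vertexRow) = rowsInput (l.map rowPair) := by
  simp only [encodeRows, rowsInput, List.flatMap_map, map_some_vertexRow]

/-- The copy with index `i'` of the vertex `j.succ` has column `j * N + i'` after the base column.
Each symbol thus expands to a block of `N` columns in which only column `i` can carry a one. -/
theorem rowPair_image (i : Fin N) (s : Finset (Fin (m + 1))) :
    (rowPair (s.image (copyVertex m i))).1 :: (rowPair (s.image (copyVertex m i))).2 ++ [none] =
      rowWord i (N - 1 - i) (rowPair s).1 (rowPair s).2 := by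
  have hφ := isWedgeFamily_copyVertex (m := m) (N := N)
  have h0 : 0 ∈ s.image (copyVertex m i) ↔ 0 ∈ s := by
    rw [← copyVertex_zero i, (hφ.injective i).mem_finset_image]
  have hsucc : ∀ (j : Fin m) (i' : Fin N),
      (finProdFinEquiv (j, i')).succ ∈ s.image (copyVertex m i) ↔ i' = i ∧ j.succ ∈ s := by
    intro j i'
    rw [← copyVertex_succ]
    constructor
    · intro h
      obtain ⟨x, hx, hxe⟩ := Finset.mem_image.1 h
      obtain rfl := hφ.disjoint _ _ _ _ hxe.symm (Fin.succ_ne_zero j)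
      rw [hφ.injective _ hxe] at hx
      exact ⟨rfl, hx⟩
    · rintro ⟨rfl, h⟩
      exact Finset.mem_image_of_mem _ h
  have hblock : ∀ b : Bool, (List.ofFn fun i' : Fin N => some (decide (i' = i) && b)) =
      List.replicate i (some false) ++ some b :: List.replicate (N - 1 - i) (some false) := by
    intro b
    have hi := i.2
    refine List.ext_getElem (by simp; omega) fun k hk hk' => ?_
    rw [List.getElem_ofFn]
    rcases lt_trichotomy k i with h | h | h
    · rw [List.getElem_append_left (by simpa using h), List.getElem_replicate]
      simp [Fin.ext_iff, h.ne]
    · subst h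
      rw [List.getElem_append_right (by simp)]
      simp
    · rw [List.getElem_append_right (by simpa using h.le)]
      obtain ⟨d, hd⟩ := Nat.exists_eq_add_of_lt h
      have : k - (List.replicate (i : ℕ) (some false)).length = d + 1 := by simp; omega
      simp only [this, List.getElem_cons_succ, List.getElem_replicate]
      simp [Fin.ext_iff, h.ne']
  have hrest : (rowPair (s.image (copyVertex m i))).2 =
      (rowPair s).2.flatMap (blockWord i (N - 1 - i)) := by
    simp only [rowPair]
    rw [List.ofFn_mul, List.flatMap_def, List.map_ofFn]
    refine congrArg (fun f => List.flatten (List.ofFn f)) (funext fun j => ?_)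
    refine Eq.trans (congrArg List.ofFn (funext fun i' => ?_)) (hblock _)
    have e : (⟨j * N + i', by
        calc (j * N + i' : ℕ) < j * N + N := by omega
          _ = (j + 1) * N := by ring
          _ ≤ m * N := Nat.mul_le_mul_right _ j.2⟩ : Fin (m * N)) = finProdFinEquiv (j, i') := by
      ext
      simp [Nat.mul_comm, Nat.add_comm]
    rw [e, Bool.decide_congr (hsucc j i')]
    simp
  rw [rowWord, ← hrest]
  congr 2
  simp [rowPair, h0]

/-- A one in front and nowhere else characterizes the row of the base vertex, so the test on words
agrees with the test on simplices. -/
theorem rowCopies_rowPair (hN : 0 < N) {s : Finset (Fin (m + 1))} (hs : s.Nonempty) :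
    rowCopies (N - 1) (rowPair s).1 (rowPair s).2 = (copyIndices hN s).length := by
  have h : ((rowPair s).1 = some true ∧ some true ∉ (rowPair s).2) ↔ s = {0} := by
    simp only [rowPair, Option.some.injEq, decide_eq_true_eq, List.mem_ofFn, not_exists]
    constructor
    · rintro ⟨h0, hT⟩
      refine Finset.eq_singleton_iff_unique_mem.2 ⟨h0, fun x hx => ?_⟩
      cases x using Fin.cases with
      | zero => rfl
      | succ j => exact absurd hx (hT j)
    · rintro rfl
      simp
  unfold rowCopies copyIndices
  by_cases hs0 : s = {0}
  · rw [if_pos (h.2 hs0), if_pos hs0]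
    rfl
  · rw [if_neg (fun h' => hs0 (h.1 h')), if_neg hs0, List.length_finRange]
    omega

theorem rowsWord_rowPair (hN : 0 < N) {s : Finset (Fin (m + 1))} (hs : s.Nonempty) :
    rowsWord (N - 1) (rowPair s).1 (rowPair s).2 =
      encodeRows ((copyIndices hN s).map fun i => vertexRow (s.image (copyVertex m i))) := by
  have hrange : List.range (copyIndices hN s).length = (copyIndices hN s).map Fin.val := by
    unfold copyIndices
    split_ifs
    · rfl
    · simp
  rw [rowsWord, rowCopies_rowPair hN hs, hrange]
  simp only [encodeRows, List.flatMap_map]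
  refine congrArg (fun f => List.flatMap f _) (funext fun i => ?_)
  rw [← rowPair_image, ← map_some_vertexRow]

/-- The word written by `amplify` is a legitimate input word, so the guarantee for the called
machine applies to it. -/
theorem encode_wedgeInput (hN : 0 < N) (K : AbstractSimplicialComplex (Fin (m + 1)))
    (l : List (Finset (Fin (m + 1)))) (hl : l.Nodup) (hK : ∀ s, s ∈ l ↔ s ∈ K.faces) :
    (wedgeInput hN K l hl hK).encode =
      (l.map rowPair).flatMap fun x => rowsWord (N - 1) x.1 x.2 := by
  have hne : ∀ s ∈ l, s.Nonempty := fun s hs => K.nonempty_of_mem ((hK s).1 hs)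
  show encodeRows ((wedgeSimplices hN l).map vertexRow) = _
  clear hl hK
  rw [List.flatMap_map]
  induction l with
  | nil => rfl
  | cons s l ih =>
    rw [List.flatMap_cons, ← ih fun t ht => hne t (by simp [ht]),
      rowsWord_rowPair hN (hne s (by simp))]
    simp [wedgeSimplices, encodeRows, Function.comp_def]

theorem size_wedgeInput (hN : 0 < N) (K : AbstractSimplicialComplex (Fin (m + 1)))
    (l : List (Finset (Fin (m + 1)))) (hl : l.Nodup) (hK : ∀ s, s ∈ l ↔ s ∈ K.faces) :
    (wedgeInput hN K l hl hK).size =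
      ((l.map rowPair).map fun x => rowCopies (N - 1) x.1 x.2).sum := by
  show (wedgeSimplices hN l).length = _
  rw [wedgeSimplices, List.length_flatMap, List.map_map]
  refine congrArg List.sum (List.map_congr_left fun s hs => ?_)
  rw [List.length_map, Function.comp_apply,
    rowCopies_rowPair hN (K.nonempty_of_mem ((hK s).1 hs))]

theorem size_wedgeInput_le (hN : 0 < N) (K : AbstractSimplicialComplex (Fin (m + 1)))
    (l : List (Finset (Fin (m + 1)))) (hl : l.Nodup) (hK : ∀ s, s ∈ l ↔ s ∈ K.faces) :
    (wedgeInput hN K l hl hK).size ≤ N * l.length := by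
  show (wedgeSimplices hN l).length ≤ _
  rw [wedgeSimplices, List.length_flatMap, Nat.mul_comm N]
  refine (List.sum_le_card_nsmul _ N ?_).trans_eq (by simp)
  intro y hy
  obtain ⟨s, -, rfl⟩ := List.mem_map.1 hy
  rw [List.length_map, copyIndices]
  split_ifs
  · exact hN
  · simp

/-! ### Counting critical simplices -/

theorem count_none_encodeRows (l : List (List Bool)) : (encodeRows l).count none = l.length := by
  induction l with
  | nil => rfl
  | cons r l ih =>
    have h : (r.map some).count none = 0 := List.count_eq_zero.2 (by simp)
    rw [encodeRows] at ih ⊢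
    rw [List.flatMap_cons, List.count_append, ih, List.count_append, h]
    simp [Nat.add_comm]

theorem count_none_encodePairs (K : ComplexInput)
    (M : List (FacePoset K.complex × FacePoset K.complex)) :
    (K.encodePairs M).count none = 2 * M.length := by
  rw [ComplexInput.encodePairs, count_none_encodeRows, List.length_flatMap]
  simp [Nat.mul_comm]

/-- The pairs are disjoint and listed without repetition, so the list of their members is free of
duplicates, and the critical simplices form its complement. Critical simplices can therefore be
counted through the length of the output. -/
theorem numCritical_add (K : ComplexInput)
    {M : List (FacePoset K.complex × FacePoset K.complex)} (hM : M.Nodup)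
    (hP : IsPartialMatching {p | p ∈ M}) :
    numCritical K.complex {p | p ∈ M} + 2 * M.length = K.size := by
  classical
  have hfin : Finite (FacePoset K.complex) := K.finite_faces.to_subtype
  let L : List (FacePoset K.complex) := M.flatMap fun p => [p.1, p.2]
  have hL : L.Nodup := by
    refine List.nodup_flatMap.2 ⟨fun p hp => ?_, ?_⟩
    · simpa using (hP.1 p hp).lt.ne
    · refine List.Pairwise.imp_of_mem ?_ hM
      intro p q hp hq hpq x hx hy
      exact hpq (hP.2 x p hp q hq (by simpa using hx) (by simpa using hy))
  have hcompl : criticalSimplices K.complex {p | p ∈ M} =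
      ((L.toFinset : Set (FacePoset K.complex)))ᶜ := by
    ext s
    simp only [criticalSimplices, L, List.coe_toFinset, List.mem_flatMap, List.mem_cons,
      List.not_mem_nil, or_false, Set.mem_compl_iff, Set.mem_ofPred_eq]
    constructor
    · rintro h ⟨p, hp, e⟩
      rcases e with e | e
      exacts [(h p hp).1 e, (h p hp).2 e]
    · intro h p hp
      exact ⟨fun e => h ⟨p, hp, .inl e⟩, fun e => h ⟨p, hp, .inr e⟩⟩
  have hlen : L.length = 2 * M.length := by
    simp [L, List.length_flatMap, Nat.mul_comm]
  have h := Set.ncard_add_ncard_compl (L.toFinset : Set (FacePoset K.complex))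
  rw [Set.ncard_coe_finset, List.toFinset_card_of_nodup hL, hlen, ← hcompl] at h
  rw [numCritical, Nat.add_comm, h, K.size_eq_ncard]
  rfl

end AmplifiedInput

/-! ### Polynomial time -/

section PolynomialTime

open Turing

/-- The values of a polynomial with natural coefficients. -/
def IsPolynomialFun (f : ℕ → ℕ) : Prop := ∃ P : Polynomial ℕ, ∀ x, P.eval x = f x

namespace IsPolynomialFun

variable {f g : ℕ → ℕ}

theorem const (a : ℕ) : IsPolynomialFun fun _ => a := ⟨Polynomial.C a, fun _ => by simp⟩

theorem id : IsPolynomialFun fun x => x := ⟨Polynomial.X, fun _ => by simp⟩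

theorem add (hf : IsPolynomialFun f) (hg : IsPolynomialFun g) :
    IsPolynomialFun fun x => f x + g x := by
  obtain ⟨P, hP⟩ := hf
  obtain ⟨Q, hQ⟩ := hg
  exact ⟨P + Q, fun x => by simp [hP, hQ]⟩

theorem mul (hf : IsPolynomialFun f) (hg : IsPolynomialFun g) :
    IsPolynomialFun fun x => f x * g x := by
  obtain ⟨P, hP⟩ := hf
  obtain ⟨Q, hQ⟩ := hg
  exact ⟨P * Q, fun x => by simp [hP, hQ]⟩

theorem pow (hf : IsPolynomialFun f) (k : ℕ) : IsPolynomialFun fun x => f x ^ k := by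
  obtain ⟨P, hP⟩ := hf
  exact ⟨P ^ k, fun x => by simp [hP]⟩

theorem eval (P : Polynomial ℕ) (hf : IsPolynomialFun f) :
    IsPolynomialFun fun x => P.eval (f x) := by
  obtain ⟨Q, hQ⟩ := hf
  exact ⟨P.comp Q, fun x => by simp [hQ, Polynomial.eval_comp]⟩

theorem multiplyIterTime (j : ℕ) : IsPolynomialFun fun x => multiplyIterTime x j := by
  induction j with
  | zero => exact const 0
  | succ j ih =>
    exact ih.add ((((const 3).mul (id.pow j)).add ((const 3).mul (id.mul (id.pow j)))).add
      (const 2))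

end IsPolynomialFun

/-- The length of the amplified word is only bounded, not known, so the time of the called machine
has to be estimated by monotonicity. -/
theorem polynomial_eval_mono (P : Polynomial ℕ) {x y : ℕ} (h : x ≤ y) : P.eval x ≤ P.eval y := by
  rw [Polynomial.eval_eq_sum, Polynomial.eval_eq_sum]
  exact Finset.sum_le_sum fun i _ => Nat.mul_le_mul_left _ (Nat.pow_le_pow_left h i)

theorem multiplyIterTime_mono {n n' : ℕ} (h : n ≤ n') (j : ℕ) :
    multiplyIterTime n j ≤ multiplyIterTime n' j := by
  induction j with
  | zero => exact le_rfl
  | succ j ih =>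
    unfold multiplyIterTime
    gcongr

theorem processTime_mono_right (M : ℕ) {m m' : ℕ} (h : m ≤ m') :
    processTime M m ≤ processTime M m' := by
  unfold processTime emitAllTime emitTime
  gcongr

theorem decideTime_mono (j : ℕ) {n n' m m' k k' L L₁ t t' L' L₁' : ℕ} (hn : n ≤ n') (hm : m ≤ m')
    (hk : k ≤ k') (hL : L ≤ L₁) (ht : t ≤ t') (hL' : L' ≤ L₁') :
    decideTime j n m k L t L' ≤ decideTime j n' m' k' L₁ t' L₁' := by
  have h1 := multiplyIterTime_mono hn j
  have h2 : processTime (n ^ j) m ≤ processTime (n' ^ j) m' :=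
    (processTime_mono (Nat.pow_le_pow_left hn j) m).trans (processTime_mono_right _ hm)
  unfold decideTime
  gcongr

/-- A bound for the length of the input word of the amplified complex. -/
def amplifiedLength (j x : ℕ) : ℕ := (x ^ j * x) * (x * x ^ j + 2)

/-- A bound for the time that `decideLarge` takes on an input word of length `x`. -/
def collapsibilityTime (j : ℕ) (P : Polynomial ℕ) (x : ℕ) : ℕ :=
  decideTime j x x (x ^ j * x) (amplifiedLength j x) (P.eval (amplifiedLength j x))
    (amplifiedLength j x)

theorem isPolynomialFun_amplifiedLength (j : ℕ) : IsPolynomialFun (amplifiedLength j) := by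
  have hx := IsPolynomialFun.id
  exact ((hx.pow j).mul hx).mul ((hx.mul (hx.pow j)).add (.const 2))

theorem isPolynomialFun_collapsibilityTime (j : ℕ) (P : Polynomial ℕ) :
    IsPolynomialFun (collapsibilityTime j P) := by
  have hx := IsPolynomialFun.id
  have hL := isPolynomialFun_amplifiedLength j
  have hemit : IsPolynomialFun fun x => emitTime (x ^ j) x :=
    ((((IsPolynomialFun.const 2).mul (hx.pow j)).add (.const 6)).mul hx).add (.const 2)
  have hproc : IsPolynomialFun fun x => processTime (x ^ j) x :=
    (((IsPolynomialFun.const 4).mul hx).add (.const 4)).add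
      ((hemit.add (.const 2)).mul ((hx.pow j).add (.const 1)))
  unfold collapsibilityTime decideTime
  exact ((((((((IsPolynomialFun.const 2).mul (hx.mul (hx.add (.const 2)))).add (.const 2)).add
    (.multiplyIterTime j)).add ((((IsPolynomialFun.const 1).add hproc).mul hx).add (.const 1))).add
    (((hL.add (hL.eval P)).add hL).add (.const 2)))).add (hL.add (.const 1))).add
    (((((IsPolynomialFun.const 2).mul ((hx.pow j).mul hx)).add (hx.pow j)).add hx).add (.const 4))

/-! ### The length of words -/

theorem length_encodeRows {l : List (List Bool)} {k : ℕ} (h : ∀ r ∈ l, r.length = k) :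
    (encodeRows l).length = l.length * (k + 1) := by
  induction l with
  | nil => simp [encodeRows]
  | cons r l ih =>
    have := ih fun r' hr' => h r' (by simp [hr'])
    rw [encodeRows] at this ⊢
    rw [List.flatMap_cons, List.length_append, this]
    simp [h r (by simp)]
    ring

namespace ComplexInput

variable (K : ComplexInput)

theorem length_encode : K.encode.length = K.size * (K.numVertices + 1) := by
  rw [encode, length_encodeRows (k := K.numVertices), List.length_map, size]
  intro r hr
  obtain ⟨s, -, rfl⟩ := List.mem_map.1 hr
  simp [vertexRow]

theorem length_encodePairs (M : List (FacePoset K.complex × FacePoset K.complex)) :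
    (K.encodePairs M).length = 2 * M.length * (K.numVertices + 1) := by
  rw [encodePairs, length_encodeRows (k := K.numVertices)]
  · simp [List.length_flatMap, Nat.mul_comm]
  · intro r hr
    obtain ⟨p, -, hp⟩ := List.mem_flatMap.1 hr
    simp only [List.mem_cons, List.not_mem_nil, or_false] at hp
    rcases hp with rfl | rfl <;> simp [vertexRow]

theorem numVertices_le_size : K.numVertices ≤ K.size := by
  have h : (Finset.univ.image fun v : Fin K.numVertices => ({v} : Finset _)) ⊆
      K.simplices.toFinset := by
    intro s hs
    obtain ⟨v, -, rfl⟩ := Finset.mem_image.1 hs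
    exact List.mem_toFinset.2 ((K.mem_simplices _).2 (K.complex.singleton_mem v))
  have h' := Finset.card_le_card h
  rw [Finset.card_image_of_injective _ Finset.singleton_injective, Finset.card_univ,
    Fintype.card_fin, List.toFinset_card_of_nodup K.nodup_simplices] at h'
  exact h'

theorem size_le_length_encode : K.size ≤ K.encode.length := by
  rw [length_encode]
  exact Nat.le_mul_of_pos_right _ (Nat.succ_pos _)

theorem numVertices_pos (h : 0 < K.size) : 0 < K.numVertices := by
  obtain ⟨s, hs⟩ := List.exists_mem_of_length_pos h
  obtain ⟨v, -⟩ := K.complex.nonempty_of_mem ((K.mem_simplices s).1 hs)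
  exact v.pos

/-- Every vertex is a simplex, so a complex with at most `k` simplices has at most `k` vertices and
a word of length at most `k * (k + 1)`. -/
theorem lt_size_of_le_length {k : ℕ} (h : k * (k + 1) + 1 ≤ K.encode.length) : k < K.size := by
  by_contra! hk
  rw [length_encode] at h
  have h1 := K.numVertices_le_size
  have : K.size * (K.numVertices + 1) ≤ k * (k + 1) := by
    gcongr
    omega
  omega

end ComplexInput

/-! ### The decision algorithm -/

-- The criterion allows any base vertex; the program uses vertex `0`, whose column is the first
-- symbol of every row.
open Classical in
theorem exec_decideLarge_encode {A : MatchingMap}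
    (h : TM2ComputableInPolyTime ComplexInput.encode (id : List (Option Bool) → _)
      (fun K : ComplexInput => K.encodePairs (A K)))
    (hA : ∀ K, (A K).Nodup ∧ IsMorseMatching K.complex (A.output K)) (j : ℕ) (K : ComplexInput)
    (hK : 0 < K.size)
    (hiff : ∀ v Q, IsAmplifiedComplex K v (j + 1) Q →
      (IsCollapsible K.complex.toPreAbstractSimplicialComplex ↔
        numCritical Q.complex (A.output Q) < K.size ^ j)) :
    Exec (Program.decideLarge h.inputAlphabet h.outputAlphabet j)
      (Regs.get { inp := K.encode }, []) (collapsibilityTime j h.time K.encode.length)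
      (fun _ => [], [decide (IsCollapsible K.complex.toPreAbstractSimplicialComplex)]) := by
  have hx1 := K.size_le_length_encode
  have hx2 := K.numVertices_le_size
  have hpos := K.numVertices_pos hK
  obtain ⟨_ | m, cx, l, nd, mem⟩ := K
  · exact absurd hpos (lt_irrefl 0)
  set K : ComplexInput := ⟨m + 1, cx, l, nd, mem⟩
  have hN : 0 < K.size ^ j := Nat.pow_pos hK
  set N := K.size ^ j with hNdef
  set Q := wedgeInput hN cx l nd mem with hQ
  have hamp : IsAmplifiedComplex K (0 : Fin (m + 1)) (j + 1) Q := ⟨wedgeVertexEquiv m N, rfl⟩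
  set x := K.encode.length with hx
  have henc : K.encode = rowsInput (l.map rowPair) := encodeRows_map_vertexRow l
  have hR : ∀ y ∈ l.map rowPair, y.1 ≠ none ∧ none ∉ y.2 ∧ y.2.length = m := by
    intro y hy
    obtain ⟨s, -, rfl⟩ := List.mem_map.1 hy
    simp [rowPair, List.mem_ofFn]
  have hlen : (l.map rowPair).length = K.size := List.length_map _
  have hW := encode_wedgeInput hN cx l nd mem
  have hs := size_wedgeInput hN cx l nd mem
  rw [← hQ] at hW hs
  have hcrit := numCritical_add Q (hA Q).1 (hA Q).2.1
  have hcount := count_none_encodePairs Q (A Q)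
  have hex := exec_decideLarge (e₀ := h.inputAlphabet) (e₁ := h.outputAlphabet) j m
    (l.map rowPair) hR (M := N - 1) (w' := Q.encodePairs (A Q)) (t := h.time.eval Q.encode.length)
    (by rw [hlen]; omega) ⟨by rw [← hW]; exact h.outputsFun Q⟩
  rw [← hs, ← hW, ← henc, hlen, hcount] at hex
  -- By `numCritical_add` the difference is the number of critical simplices, and `N` is positive.
  have hdec : decide (Q.size - 2 * (A Q).length ≤ N - 1) =
      decide (IsCollapsible K.complex.toPreAbstractSimplicialComplex) := by
    refine Bool.decide_congr ?_
    rw [hiff _ Q hamp]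
    change _ ↔ numCritical Q.complex {p | p ∈ A Q} < N
    omega
  rw [hdec] at hex
  refine hex.mono ?_
  have hmx : m ≤ x := by
    have : m + 1 ≤ K.size := hx2
    omega
  have hNx : N ≤ x ^ j := Nat.pow_le_pow_left hx1 j
  have hQsize : Q.size ≤ x ^ j * x := by
    have h1 : Q.size ≤ N * K.size := size_wedgeInput_le hN cx l nd mem
    exact h1.trans (Nat.mul_le_mul hNx hx1)
  have hv : Q.numVertices + 1 ≤ x * x ^ j + 2 := by
    exact Nat.add_le_add_right (Nat.mul_le_mul hmx hNx) 2
  have hL : Q.encode.length ≤ amplifiedLength j x := by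
    rw [Q.length_encode]
    exact Nat.mul_le_mul hQsize hv
  have hL' : (Q.encodePairs (A Q)).length ≤ amplifiedLength j x := by
    rw [Q.length_encodePairs]
    -- The matched simplices are among those of `Q`, so the output has at most `Q.size` rows.
    exact Nat.mul_le_mul (by omega) hv
  exact decideTime_mono j hx1 hmx hQsize hL (polynomial_eval_mono _ hL) hL'

/-- A long input word belongs to a complex above the size threshold, where the criterion decides;
the short words are finite in number and are answered by the table. -/
theorem collapsibilityIsPolyTime_of_isMinMMApproximation {A : MatchingMap}
    (hP : A.IsPolyTime) (hA : ∀ K, (A K).Nodup ∧ IsMorseMatching K.complex (A.output K))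
    (j k : ℕ) (hiff : ∀ K : ComplexInput, k < K.size → ∀ v Q, IsAmplifiedComplex K v (j + 1) Q →
      (IsCollapsible K.complex.toPreAbstractSimplicialComplex ↔
        numCritical Q.complex (A.output Q) < K.size ^ j)) :
    CollapsibilityIsPolyTime := by
  classical
  obtain ⟨h⟩ := hP
  obtain ⟨P, hPx⟩ := (isPolynomialFun_collapsibilityTime j h.time).add (.const 1)
  -- Only the values at words of length at most `k * (k + 1)` enter the machine, so the table need
  -- not be computed. It is correct because `ComplexInput.encode` is injective.
  let table : List (Option Bool) → Bool := fun w => decide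
    (∃ K : ComplexInput, K.encode = w ∧ IsCollapsible K.complex.toPreAbstractSimplicialComplex)
  have htable : ∀ K : ComplexInput, table K.encode =
      decide (IsCollapsible K.complex.toPreAbstractSimplicialComplex) := by
    intro K
    refine Bool.decide_congr ⟨?_, fun h => ⟨K, rfl, h⟩⟩
    rintro ⟨K', e, h⟩
    rwa [ComplexInput.encode_injective e] at h
  let F := Program.lookup table
    (Program.decideLarge h.inputAlphabet h.outputAlphabet j) (k * (k + 1) + 1) []
  have hF : ∀ K : ComplexInput, Exec F (Regs.get { inp := K.encode }, [])
      (collapsibilityTime j h.time K.encode.length)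
      (fun _ => [], [decide (IsCollapsible K.complex.toPreAbstractSimplicialComplex)]) := by
    intro K
    rcases lt_or_ge K.encode.length (k * (k + 1) + 1) with hlt | hge
    · rw [← htable K]
      exact (exec_lookup_short table _ _ [] K.encode hlt).mono (Nat.zero_le _)
    · have hk := K.lt_size_of_le_length hge
      exact exec_lookup_long table hge
        (exec_decideLarge_encode h hA j K (Nat.zero_lt_of_lt hk) (hiff K hk))
  have hinp : ∀ w, Function.update (fun _ => []) Stack.inp w = Regs.get { inp := w } := by
    intro w
    funext o
    cases o <;> rfl
  have hout : ∀ K : ComplexInput, Nonempty (TM2OutputsInTime (F.machine .inp) K.encode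
      (some [decide (IsCollapsible K.complex.toPreAbstractSimplicialComplex)])
      (P.eval K.encode.length)) := by
    intro K
    rw [hPx]
    exact F.machine_outputs .inp (by rw [hinp]; exact hF K)
  exact ⟨{
    tm := F.machine .inp
    inputAlphabet := Equiv.refl (Option Bool)
    outputAlphabet := Equiv.refl Bool
    time := P
    outputsFun := fun K => by
      exact (congrArg (fun w : List (Option Bool) => TM2OutputsInTime (F.machine .inp) w
        (some [decide (IsCollapsible K.complex.toPreAbstractSimplicialComplex)])
          (P.eval K.encode.length)) (List.map_id K.encode)).mpr (Classical.choice (hout K)) }⟩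

end PolynomialTime

/-! ### The theorem -/

theorem mainTheorem10 (ε : ℝ) (hε0 : 0 < ε) (hε1 : ε ≤ 1)
    (A : MatchingMap) (α : ℕ → ℝ)
    (hα : α =O[Filter.atTop] fun n : ℕ => (n : ℝ) ^ (1 - ε))
    (hA : IsMinMMApproximation α A) :
    CollapsibilityIsPolyTime ∧
    ∀ (c : ℕ) (p N : ℝ), c = ⌊1 / ε + 1⌋₊ → 0 < p → 0 < N →
      (∀ n : ℕ, N ≤ n → α n ≤ p * (n : ℝ) ^ (1 - ε)) →
      ∀ (K : ComplexInput) (v : Fin K.numVertices) (Q : ComplexInput),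
        max (p ^ (1 / (c * ε - 1))) N < K.size → IsAmplifiedComplex K v c Q →
        (IsCollapsible K.complex.toPreAbstractSimplicialComplex ↔
          numCritical Q.complex (A.output Q) < K.size ^ (c - 1)) := by
  have key := fun (c : ℕ) (p N : ℝ) (hc : c = ⌊1 / ε + 1⌋₊) (hp : 0 < p)
    (h : ∀ n : ℕ, N ≤ n → α n ≤ p * (n : ℝ) ^ (1 - ε)) =>
      isCollapsible_iff_numCritical_lt hε0 hε1 hA hc hp h
  refine ⟨?_, fun c p N hc hp _ h K v Q => key c p N hc hp h K v Q⟩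
  -- The decision algorithm may fix any admissible constants; those of the asymptotic bound are
  -- built in.
  obtain ⟨p, hp, hb⟩ := hα.exists_pos
  obtain ⟨N, hN⟩ := Filter.eventually_atTop.1 hb.bound
  have hαp : ∀ n : ℕ, (N : ℝ) ≤ n → α n ≤ p * (n : ℝ) ^ (1 - ε) := by
    intro n hn
    have h := hN n (by exact_mod_cast hn)
    rw [Real.norm_of_nonneg (Real.rpow_nonneg n.cast_nonneg _)] at h
    exact (le_abs_self _).trans h
  obtain ⟨c, hc⟩ : ∃ c, c = ⌊1 / ε + 1⌋₊ := ⟨_, rfl⟩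
  have hc1 : 1 ≤ c := by
    rw [hc]
    exact Nat.le_floor (by push_cast; linarith [one_div_pos.2 hε0])
  -- Complexes with at most `k` simplices are the ones left to the table.
  obtain ⟨k, hk⟩ := exists_nat_ge (max (p ^ (1 / (c * ε - 1))) (N : ℝ))
  refine collapsibilityIsPolyTime_of_isMinMMApproximation hA.1
    (fun K => ⟨(hA.2 K).1, (hA.2 K).2.1⟩) (c - 1) k fun K hK v Q hQ => ?_
  rw [Nat.sub_add_cancel hc1] at hQ
  exact key c p N hc hp hαp K v Q (hk.trans_lt (by exact_mod_cast hK)) hQ
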